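/- Let $A$ be a finite alphabet and give $A^{\mathbb Z}$ the product topology. Let $X\subset A^{\mathbb Z}$ be invariant under the left shift (not necessarily closed), locally compact in the relative topology, and minimal, i.e. the orbit $\{T^nx : n\in\mathbb Z\}$ of every $x\in X$ is dense in $X$, where $T:X\to X$ is the left shift $(Tx)_i=x_{i+1}$. Let $K\subset X$ be a nonempty, compact open subset of $X$, and let $\omega\in K$ be a point which returns to $K$ infinitely many times; write $\{k\ge 0 : T^k\omega\in K\}=\{k_0<k_1<k_2<\dots\}$, so that $k_0=0$. For a nonempty finite word $v$ over $A$ put $[v]=\{x\in X : x_0x_1\cdots x_{|v|-1}=v\}$, let $N(v,w)$ denote the number of (possibly overlapping) occurrences of $v$ in a finite word $w$, and let $\omega_{[a,b]}=\omega_a\omega_{a+1}\cdots\omega_b$. A Radon measure on $X$ is a positive Borel measure that is finite on compact subsets of $X$. Then the following are equivalent: (i) $X$ has a unique (up to scaling) invariant Radon measure, i.e. there is a nonzero $T$-invariant Radon measure on $X$, and every $T$-invariant Radon measure on $X$ is a scalar multiple of it; (ii) for every nonempty word $v$ which occurs in some point of $X$ and satisfies $[v]\subset K$, there is a constant $c_v\in\mathbb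 R$ such that $$\lim_{n\to\infty}\frac1n N\bigl(v,\omega_{[k_j,k_{j+n}]}\bigr)=c_v\quad\text{uniformly in } j\ge 0.$$ Furthermore, if these conditions hold, then the nonzero invariant Radon measure, unique up to scaling, is ergodic: every Borel set $B\subset X$ with $T^{-1}B=B$ is null or has null complement. -/

import Mathlib

open MeasureTheory Filter Set
open scoped NNReal

namespace Subshift

variable {A : Type*}

/-- The left shift on bi-infinite sequences over `A`. -/
def shift (x : ℤ → A) : ℤ → A := fun i => x (i + 1)

/-- The two-sided orbit of `x` under the left shift. -/
def orbit (x : ℤ → A) : Set (ℤ → A) := Set.range fun n : ℤ => fun i : ℤ => x (i + n)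

/-- `X` is a shift-invariant set of bi-infinite sequences (not assumed closed) in which every
two-sided orbit is dense. -/
structure IsMinimal [TopologicalSpace A] (X : Set (ℤ → A)) : Prop where
  invariant : shift ⁻¹' X = X
  dense_orbit : ∀ x ∈ X, X ⊆ closure (orbit x)

/-- The left shift `T : X → X`. -/
def IsMinimal.map [TopologicalSpace A] {X : Set (ℤ → A)} (hX : IsMinimal X) : X → X :=
  fun x => ⟨shift x.1, (Set.ext_iff.mp hX.invariant x.1).mpr x.2⟩

/-- The word `x_i x_{i+1} … x_{i+n-1}` of length `n`. -/
def factor (x : ℤ → A) (i : ℤ) (n : ℕ) : List A := List.ofFn fun t : Fin n => x (i + (t : ℕ))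

/-- The word `x_{[a,b]} = x_a x_{a+1} … x_b`, both end points included. -/
def block (x : ℤ → A) (a b : ℤ) : List A := factor x a (b - a + 1).toNat

/-- The language of `X`: all finite words occurring in some point of `X`. -/
def language (X : Set (ℤ → A)) : Set (List A) :=
  {w | ∃ x ∈ X, ∃ i : ℤ, factor x i w.length = w}

/-- The cylinder set `[v] = {x ∈ X ; x_{[0,|v|)} = v}`. -/
def cylinder (X : Set (ℤ → A)) (v : List A) : Set X := {x | factor x.1 0 v.length = v}

/-- `N(u, w)`: the number of (possibly overlapping) occurrences of `u` in `w`. -/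
noncomputable def numOcc (u w : List A) : ℕ :=
  Set.ncard {i : ℕ | i < w.length ∧ (w.drop i).take u.length = u}

end Subshift

/-- A `T`-invariant positive Borel measure that is finite on compact sets. -/
structure IsInvariantRadon {Y : Type*} [TopologicalSpace Y] [MeasurableSpace Y]
    (T : Y → Y) (μ : Measure Y) : Prop where
  lt_top_of_isCompact : ∀ C : Set Y, IsCompact C → μ C < ⊤
  measurePreserving : MeasurePreserving T μ μ

/-- There is a nonzero `T`-invariant Radon measure, and all `T`-invariant Radon measures are
scalar multiples of it. -/
def HasUniqueInvariantRadon {Y : Type*} [TopologicalSpace Y] [MeasurableSpace Y]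
    (T : Y → Y) : Prop :=
  ∃ μ : Measure Y, IsInvariantRadon T μ ∧ μ ≠ 0 ∧
    ∀ ν : Measure Y, IsInvariantRadon T ν → ∃ c : ℝ≥0, ν = c • μ

namespace Subshift

/-! ### Translations and recurrence of orbits -/

section Translate

variable {A : Type*} [TopologicalSpace A] {X : Set (ℤ → A)}

/-! For (i) ⇒ (ii), take the counting measures of the orbit of ω over windows [k_j, k_{j+n}),
divided by n. A compact support is covered by finitely many translates of K, so averages of test
functions stay bounded. As n → ∞, ultrafilter limits therefore exist and are invariant Radon
measures giving K mass 1 (`exists_limit_measure`). If the frequencies of v did not converge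
uniformly to ρ[v]/ρ(K), a sequence of bad windows would produce a limit that is not a multiple of ρ
(`exists_frequency`).

For (ii) ⇒ (i), the same limits give existence. For uniqueness, mass transport shows that the
integral over K of the number of visits to V ⊆ K before the N-th visit to K equals N μ(V), for every
invariant Radon measure μ (`lintegral_encard_visits`). Almost every point of K returns infinitely
often and sees, until its N-th visit, a pattern that ω shows from some k_j on. Uniform frequencies
thus force μ[v] = c_v μ(K) (`measure_eq_of_frequency`).

Two points remain, since the cylinders [v] are one-sided. First, K must contain a nonempty one:
minimality and compactness make coordinates on the left determined, somewhere, by those on the right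
(`exists_cylinder_subset`). Second, the values on the subcylinders of one cylinder V must determine
μ: almost every orbit visits V in the past, and cutting a set according to the last such visit and
shifting moves the pieces into V (`measure_ext`).

Ergodicity follows because restricting to an invariant set gives another invariant Radon measure,
hence a multiple of the same one. -/

theorem IsMinimal.translate_mem (hX : IsMinimal X) (n : ℤ) {x : ℤ → A} (hx : x ∈ X) :
    (fun i => x (i + n)) ∈ X := by
  induction n using Int.induction_on with
  | zero => simpa using hx
  | succ n ih =>
    have : shift (fun i => x (i + n)) ∈ X := (Set.ext_iff.mp hX.invariant _).mpr ih
    convert this using 1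
    funext i
    simp only [shift]
    congr 1
    ring
  | pred n ih =>
    refine (Set.ext_iff.mp hX.invariant _).mp ?_
    simp only [mem_preimage]
    convert ih using 1
    funext i
    simp only [shift]
    congr 1
    ring

/-- The translation of `X` by `n`, that is, the `n`-th power of the left shift. -/
def IsMinimal.translate (hX : IsMinimal X) (n : ℤ) (x : X) : X :=
  ⟨fun i => x.1 (i + n), hX.translate_mem n x.2⟩

@[simp]
theorem IsMinimal.translate_apply (hX : IsMinimal X) (n : ℤ) (x : X) (i : ℤ) :
    (hX.translate n x).1 i = x.1 (i + n) := rfl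

theorem IsMinimal.translate_zero (hX : IsMinimal X) (x : X) : hX.translate 0 x = x := by
  ext i; simp

theorem IsMinimal.translate_add (hX : IsMinimal X) (m n : ℤ) (x : X) :
    hX.translate (m + n) x = hX.translate m (hX.translate n x) := by
  ext i; simp [add_assoc]

theorem IsMinimal.translate_one (hX : IsMinimal X) : hX.translate 1 = hX.map := rfl

theorem IsMinimal.map_iterate (hX : IsMinimal X) (n : ℕ) (x : X) :
    hX.map^[n] x = hX.translate n x := by
  induction n with
  | zero => simp [hX.translate_zero]
  | succ n ih =>
    rw [Function.iterate_succ_apply', ih, ← hX.translate_one, ← hX.translate_add]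
    congr 1
    push_cast
    ring

theorem IsMinimal.continuous_translate (hX : IsMinimal X) (n : ℤ) :
    Continuous (hX.translate n) := by
  refine Continuous.subtype_mk ?_ _
  exact continuous_pi fun i => (continuous_apply (i + n)).comp continuous_subtype_val

theorem IsMinimal.exists_translate_mem (hX : IsMinimal X) {U : Set X} (hU : IsOpen U)
    (hne : U.Nonempty) (x : X) : ∃ n : ℤ, hX.translate n x ∈ U := by
  obtain ⟨O, hO, rfl⟩ := isOpen_induced_iff.mp hU
  obtain ⟨z, hz⟩ := hne
  obtain ⟨y, hyO, n, rfl⟩ := mem_closure_iff.mp (hX.dense_orbit x.1 x.2 z.2) O hO hz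
  exact ⟨n, hyO⟩

theorem isClopen_setOf_eqOn [DiscreteTopology A] (x : ℤ → A) (a b : ℤ) :
    IsClopen {y : X | EqOn y.1 x (Ico a b)} := by
  have : {y : X | EqOn y.1 x (Ico a b)} =
      ⋂ i ∈ Finset.Ico a b, (fun y : X => y.1 i) ⁻¹' {x i} := by
    ext y
    simp [EqOn]
  rw [this]
  refine isClopen_biInter_finset fun i _ => (isClopen_discrete _).preimage ?_
  exact (continuous_apply i).comp continuous_subtype_val

theorem exists_eqOn_subset {U : Set X} (hU : IsOpen U) {x : X}
    (hx : x ∈ U) : ∃ m : ℕ, {y : X | EqOn y.1 x.1 (Ico (-m) m)} ⊆ U := by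
  obtain ⟨O, hO, rfl⟩ := isOpen_induced_iff.mp hU
  obtain ⟨I, u, hu, hIu⟩ := isOpen_pi_iff.mp hO x.1 hx
  obtain ⟨m, hm⟩ : ∃ m : ℕ, ∀ i ∈ I, i.natAbs < m :=
    ⟨I.sup Int.natAbs + 1, fun i hi => Nat.lt_succ_of_le (Finset.le_sup (f := Int.natAbs) hi)⟩
  refine ⟨m, fun y hy => hIu fun i hi => ?_⟩
  rw [hy (by have := hm i hi; constructor <;> omega)]
  exact (hu i hi).2

end Translate

/-- A point whose forward orbit comes back to a compact set infinitely often has a forward orbit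
that meets every nonempty open set at arbitrarily late times. -/
theorem IsMinimal.exists_ge_translate_mem {A : Type*} [TopologicalSpace A] {X : Set (ℤ → A)}
    (hX : IsMinimal X) {K : Set X} (hK : IsCompact K) {ω : X}
    (hret : ∀ N : ℕ, ∃ m : ℕ, N ≤ m ∧ hX.translate m ω ∈ K)
    {U : Set X} (hU : IsOpen U) (hne : U.Nonempty) (N : ℕ) :
    ∃ m : ℕ, N ≤ m ∧ hX.translate m ω ∈ U := by
  choose t ht htK using hret
  -- The returns to K cluster at some z ∈ K. The orbit of z meets U at a time p, so late returns
  -- near z meet U after a further p steps.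
  obtain ⟨z, -, hz⟩ := hK (f := Filter.map (fun i => hX.translate (t i) ω) atTop)
    (Filter.le_principal_iff.mpr (Filter.mem_map.mpr (Eventually.of_forall htK)))
  obtain ⟨p, hp⟩ := hX.exists_translate_mem hU hne z
  have hopen : IsOpen (hX.translate p ⁻¹' U) := hU.preimage (hX.continuous_translate p)
  have hfreq := (mapClusterPt_iff_frequently.mp hz) _ (hopen.mem_nhds hp)
  obtain ⟨i, hi, hiU⟩ := frequently_atTop.mp hfreq (N + p.natAbs)
  refine ⟨(t i + p).toNat, ?_, ?_⟩
  · have := ht i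
    omega
  · have := ht i
    rw [Int.toNat_of_nonneg (by omega), add_comm, hX.translate_add]
    exact hiU

/-- If one point visits the open set `U` infinitely often, every point does. -/
theorem IsMinimal.infinite_visits {A : Type*} [TopologicalSpace A] {X : Set (ℤ → A)}
    (hX : IsMinimal X) {U : Set X} (hU : IsOpen U) {ω : X}
    (hω : {n : ℤ | hX.translate n ω ∈ U}.Infinite) (x : X) :
    {n : ℤ | hX.translate n x ∈ U}.Infinite := by
  intro hfin
  -- One more visit of ω than x has in total; a point of the orbit of x close to ω makes all these
  -- visits too.
  obtain ⟨S, hS, hcard⟩ := hω.exists_subset_card_eq (hfin.toFinset.card + 1)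
  have hopen : IsOpen (⋂ i ∈ S, hX.translate i ⁻¹' U) :=
    isOpen_biInter_finset fun i _ => hU.preimage (hX.continuous_translate i)
  obtain ⟨p, hp⟩ := hX.exists_translate_mem hopen
    ⟨ω, by simpa using fun i hi => hS hi⟩ x
  have hsub : S.image (· + p) ⊆ hfin.toFinset := by
    intro n hn
    obtain ⟨i, hi, rfl⟩ := Finset.mem_image.mp hn
    have := mem_iInter₂.mp hp i hi
    simpa [hX.translate_add] using this
  have := Finset.card_le_card hsub
  rw [Finset.card_image_of_injective _ (add_left_injective p)] at this
  omega

end Subshift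

namespace Subshift

/-! ### One-sided cylinders inside open sets -/

section Forcing

theorem factor_eq_iff {A : Type*} {x : ℤ → A} {i : ℤ} {v : List A} :
    factor x i v.length = v ↔ ∀ t (ht : t < v.length), x (i + t) = v[t] := by
  constructor
  · intro h t ht
    have : (factor x i v.length)[t]'(by rw [h]; exact ht) = v[t] := by simp only [h]
    rw [← this]
    simp [factor]
  · intro h
    refine List.ext_getElem (by simp [factor]) fun t h1 h2 => ?_
    rw [← h t h2]
    simp [factor]

theorem cylinder_factor {A : Type*} {X : Set (ℤ → A)} (x : X) (n : ℕ) :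
    cylinder X (factor x.1 0 n) = {y : X | EqOn y.1 x.1 (Ico 0 n)} := by
  ext y
  simp only [cylinder, mem_ofPred_eq, factor_eq_iff]
  constructor
  · intro h i hi
    obtain ⟨h1, h2⟩ := hi
    have := h i.toNat (by simp [factor]; omega)
    simpa [factor, h1] using this
  · intro h t ht
    have ht' : t < n := by simpa [factor] using ht
    simp only [factor, List.getElem_ofFn]
    exact h ⟨by omega, by omega⟩

variable {A : Type*} [TopologicalSpace A] {X : Set (ℤ → A)}

/-- If `x(-1)` is never determined by the coordinates to its right, then points can be modified so
as to avoid a given word in a long stretch of the past. -/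
theorem IsMinimal.exists_avoiding_past (hX : IsMinimal X) {x₀ : X} {r : ℕ}
    (H : ∀ x : X, EqOn x.1 x₀.1 (Ico 0 r) → ∀ R : ℕ, ∃ y : X,
      EqOn y.1 x.1 (Ico 0 R) ∧ y.1 (-1) ≠ x₀.1 (-1))
    {x : X} (hx : EqOn x.1 x₀.1 (Ico 0 r)) (n R : ℕ) :
    ∃ y : X, EqOn y.1 x.1 (Ico 0 R) ∧
      ∀ j : ℕ, j ≤ n → ¬ EqOn (hX.translate (-j) y).1 x₀.1 (Ico (-1) r) := by
  induction n generalizing R with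
  | zero =>
    obtain ⟨y, hy, hya⟩ := H x hx R
    refine ⟨y, hy, fun j hj h => hya ?_⟩
    obtain rfl : j = 0 := by omega
    have := h (show (-1 : ℤ) ∈ Ico (-1) (r : ℤ) by constructor <;> omega)
    simpa using this
  | succ n ih =>
    obtain ⟨y, hy, hyn⟩ := ih (max R r)
    -- Only a bad match at time -(n + 1) needs repair. The repair keeps everything to the right of
    -- the altered coordinate up to `max R r`, so the times already treated, whose words end before
    -- `r`, are unaffected.
    by_cases hc : EqOn (hX.translate (-(n + 1 : ℕ)) y).1 x₀.1 (Ico (-1) r)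
    · obtain ⟨y', hy', hya⟩ := H (hX.translate (-(n + 1 : ℕ)) y)
        (hc.mono (Ico_subset_Ico_left (by norm_num))) (max R r + n + 1)
      have key : EqOn (hX.translate (n + 1 : ℕ) y').1 y.1 (Ico (-(n + 1 : ℕ)) (max R r : ℕ)) := by
        intro i hi
        have hi' : i + (n + 1 : ℕ) ∈ Ico (0 : ℤ) (max R r + n + 1 : ℕ) := by
          obtain ⟨h1, h2⟩ := hi
          constructor <;> push_cast at * <;> omega
        rw [IsMinimal.translate_apply, hy' hi', IsMinimal.translate_apply]
        exact congrArg y.1 (by ring)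
      refine ⟨hX.translate (n + 1 : ℕ) y', ?_, fun j hj h => ?_⟩
      · intro i hi
        have h1 : i ∈ Ico (-(n + 1 : ℕ) : ℤ) (max R r : ℕ) := by
          obtain ⟨h1, h2⟩ := hi
          constructor <;> push_cast at * <;> omega
        have h2 : i ∈ Ico (0 : ℤ) (max R r : ℕ) := by
          obtain ⟨h1, h2⟩ := hi
          constructor <;> push_cast at * <;> omega
        rw [key h1, hy h2]
      · rcases Nat.lt_or_ge n j with hj' | hj'
        · obtain rfl : j = n + 1 := by omega
          rw [← hX.translate_add, neg_add_cancel, hX.translate_zero] at h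
          exact hya (h (show (-1 : ℤ) ∈ Ico (-1) (r : ℤ) by constructor <;> omega))
        · refine hyn j hj' fun i hi => ?_
          rw [← h hi, IsMinimal.translate_apply, IsMinimal.translate_apply, key]
          obtain ⟨h1, h2⟩ := hi
          constructor <;> push_cast at * <;> omega
    · refine ⟨y, hy.mono (Ico_subset_Ico_right (by simp)), fun j hj => ?_⟩
      rcases Nat.lt_or_ge n j with hj' | hj'
      · obtain rfl : j = n + 1 := by omega
        exact hc
      · exact hyn j hj'

variable [DiscreteTopology A]

/-- Otherwise the past can be altered to avoid the word of x₀ on [-1, r) for as long as desired.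
This contradicts either the bounded waiting time given by compactness or the density of the forward
orbit of ω. -/
theorem IsMinimal.exists_determined_of_isCompact (hX : IsMinimal X) {ω : X}
    (hω : ∀ U : Set X, IsOpen U → U.Nonempty → ∀ N : ℕ, ∃ m : ℕ, N ≤ m ∧ hX.translate m ω ∈ U)
    {x₀ : X} {r : ℕ} (hE : IsCompact {x : X | EqOn x.1 x₀.1 (Ico 0 r)}) :
    ∃ x : X, EqOn x.1 x₀.1 (Ico (-1) r) ∧ ∃ R : ℕ, ∀ y : X, EqOn y.1 x.1 (Ico 0 R) →
      y.1 (-1) = x.1 (-1) := by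
  by_contra! H'
  have H : ∀ x : X, EqOn x.1 x₀.1 (Ico 0 r) → ∀ R : ℕ, ∃ y : X,
      EqOn y.1 x.1 (Ico 0 R) ∧ y.1 (-1) ≠ x₀.1 (-1) := by
    intro x hx R
    by_cases hxa : x.1 (-1) = x₀.1 (-1)
    · rw [← hxa]
      refine H' x (fun i hi => ?_) R
      rcases eq_or_lt_of_le hi.1 with h | h
      · rw [← h, hxa]
      · exact hx ⟨by omega, hi.2⟩
    · exact ⟨x, eqOn_refl _ _, hxa⟩
  set E : Set X := {x : X | EqOn x.1 x₀.1 (Ico 0 r)} with hEdef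
  set Ea : Set X := {x : X | EqOn x.1 x₀.1 (Ico (-1) r)} with hEa
  have hEac : IsClopen Ea := isClopen_setOf_eqOn _ _ _
  have hEan : Ea.Nonempty := ⟨x₀, eqOn_refl _ _⟩
  -- Compactness bounds the two-sided waiting time for `Ea`, uniformly over `E`.
  obtain ⟨N, hN⟩ : ∃ N : ℕ, ∀ x ∈ E, ∃ n : ℤ, n.natAbs ≤ N ∧ hX.translate n x ∈ Ea := by
    obtain ⟨t, ht⟩ := hE.elim_finite_subcover (fun n : ℤ => hX.translate n ⁻¹' Ea)
      (fun n => hEac.isOpen.preimage (hX.continuous_translate n))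
      (fun x _ => mem_iUnion.mpr (hX.exists_translate_mem hEac.isOpen hEan x))
    refine ⟨t.sup Int.natAbs, fun x hx => ?_⟩
    obtain ⟨n, hn, hnx⟩ := mem_iUnion₂.mp (ht hx)
    exact ⟨n, Finset.le_sup (f := Int.natAbs) hn, hnx⟩
  -- If some point of `Ea` has no forward return within N steps, altering its past yields a point of
  -- `E` that misses `Ea` at all times in [-N, N].
  by_cases hcase : ∃ x ∈ Ea, ∀ n : ℕ, 1 ≤ n → n ≤ N → hX.translate n x ∉ Ea
  · obtain ⟨x, hxa, hx⟩ := hcase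
    have hxE : EqOn x.1 x₀.1 (Ico 0 r) := EqOn.mono (Ico_subset_Ico_left (by norm_num)) hxa
    obtain ⟨y, hy, hyn⟩ := hX.exists_avoiding_past H hxE N (r + N)
    have hyE : y ∈ E := fun i hi => by
      rw [hy ⟨hi.1, by have := hi.2; push_cast; omega⟩, hxE hi]
    obtain ⟨n, hn, hny⟩ := hN y hyE
    rcases le_or_gt n 0 with h0 | h0
    · refine hyn n.natAbs hn ?_
      have : -(n.natAbs : ℤ) = n := by omega
      rw [this]
      exact hny
    · refine hx n.natAbs (by omega) hn fun i hi => ?_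
      have : (n.natAbs : ℤ) = n := by omega
      rw [this, ← hny hi, IsMinimal.translate_apply, IsMinimal.translate_apply, hy]
      obtain ⟨h1, h2⟩ := hi
      constructor <;> push_cast <;> omega
  · push Not at hcase
    obtain ⟨m₀, -, hm₀⟩ := hω Ea hEac.isOpen hEan 0
    -- In the other case the visits of ω to `Ea` have gaps at most N from `m₀` on, yet ω comes close
    -- to a point that misses `Ea` at the times -N, …, 0.
    have hsyn : ∀ M : ℕ, ∃ m : ℕ, m₀ + M ≤ m ∧ m ≤ m₀ + M + N ∧ hX.translate m ω ∈ Ea := by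
      intro M
      induction M with
      | zero => exact ⟨m₀, by omega, by omega, hm₀⟩
      | succ M ih =>
        obtain ⟨m, h1, h2, h3⟩ := ih
        rcases eq_or_lt_of_le h1 with h | h
        · obtain ⟨n, hn1, hn2, hn⟩ := hcase _ h3
          rw [← hX.translate_add, ← Nat.cast_add] at hn
          exact ⟨n + m, by omega, by omega, hn⟩
        · exact ⟨m, by omega, by omega, h3⟩
    obtain ⟨y, -, hy⟩ := hX.exists_avoiding_past H (eqOn_refl x₀.1 _) N 0
    have hopen : IsOpen (⋂ j ∈ Finset.range (N + 1), hX.translate (-(j : ℤ)) ⁻¹' Eaᶜ) :=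
      isOpen_biInter_finset fun j _ =>
        hEac.compl.isOpen.preimage (hX.continuous_translate _)
    obtain ⟨M, hM, hMy⟩ := hω _ hopen
      ⟨y, mem_iInter₂.mpr fun j hj => hy j (Nat.lt_succ_iff.mp (Finset.mem_range.mp hj))⟩ (m₀ + N)
    obtain ⟨m, h1, h2, h3⟩ := hsyn (M - m₀ - N)
    refine mem_iInter₂.mp hMy (M - m) (Finset.mem_range.mpr (by omega)) ?_
    rw [← hX.translate_add]
    have : -((M - m : ℕ) : ℤ) + M = m := by omega
    rw [this]
    exact h3

/-- Reduces to the compact case: the word of x₀ occurs in ω, and prolonging it there until it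
contains a word around ω that forces membership in K makes its cylinder a closed subset of a
translate of K. -/
theorem IsMinimal.exists_determined (hX : IsMinimal X) {ω : X}
    (hω : ∀ U : Set X, IsOpen U → U.Nonempty → ∀ N : ℕ, ∃ m : ℕ, N ≤ m ∧ hX.translate m ω ∈ U)
    {K : Set X} (hKc : IsCompact K) (hKo : IsOpen K) (hωK : ω ∈ K) (x₀ : X) (r : ℕ) :
    ∃ x : X, EqOn x.1 x₀.1 (Ico (-1) r) ∧ ∃ R : ℕ, ∀ y : X, EqOn y.1 x.1 (Ico 0 R) →
      y.1 (-1) = x.1 (-1) := by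
  obtain ⟨q, hq⟩ := exists_eqOn_subset hKo hωK
  obtain ⟨m, -, hm⟩ := hω _ (isClopen_setOf_eqOn (X := X) x₀.1 (-1) r).isOpen
    ⟨x₀, eqOn_refl _ _⟩ 0
  obtain ⟨m', hm', hmK⟩ := hω _ (isClopen_setOf_eqOn (X := X) ω.1 (-q) q).isOpen
    ⟨ω, eqOn_refl _ _⟩ (m + q)
  have hE : IsCompact {x : X | EqOn x.1 (hX.translate m ω).1 (Ico 0 (max r (m' - m + q) : ℕ))} := by
    refine (hKc.image (hX.continuous_translate (-(m' - m : ℕ)))).of_isClosed_subset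
      (isClopen_setOf_eqOn _ _ _).isClosed fun x hx => ?_
    refine ⟨hX.translate (m' - m : ℕ) x, hq fun i hi => ?_, ?_⟩
    · rw [← hmK hi, IsMinimal.translate_apply, hx, IsMinimal.translate_apply,
        IsMinimal.translate_apply]
      · exact congrArg ω.1 (by push_cast [Nat.cast_sub (show m ≤ m' by omega)]; ring)
      · obtain ⟨h1, h2⟩ := hi
        constructor <;> push_cast <;> omega
    · rw [← hX.translate_add, neg_add_cancel, hX.translate_zero]
  obtain ⟨x, hx, R, hR⟩ := hX.exists_determined_of_isCompact hω hE
  refine ⟨x, fun i hi => ?_, R, hR⟩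
  rw [hx ⟨hi.1, lt_of_lt_of_le hi.2 (by simp)⟩]
  exact hm hi

/-- Up to a modification far away, the coordinates in `[-m, R)` are determined by those
in `[0, R)`. -/
theorem IsMinimal.exists_forcing (hX : IsMinimal X) {ω : X}
    (hω : ∀ U : Set X, IsOpen U → U.Nonempty → ∀ N : ℕ, ∃ m : ℕ, N ≤ m ∧ hX.translate m ω ∈ U)
    {K : Set X} (hKc : IsCompact K) (hKo : IsOpen K) (hωK : ω ∈ K) (m : ℕ) (x₀ : X) (r : ℕ) :
    ∃ x : X, EqOn x.1 x₀.1 (Ico (-m) r) ∧ ∃ R : ℕ, ∀ y : X, EqOn y.1 x.1 (Ico 0 R) →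
      EqOn y.1 x.1 (Ico (-m) R) := by
  induction m generalizing x₀ r with
  | zero => exact ⟨x₀, eqOn_refl _ _, 0, fun y hy => by simp at hy ⊢⟩
  | succ m ih =>
    -- The new coordinate -m - 1 is treated first, at position -1 after a shift by m. The induction
    -- hypothesis is then applied with a window long enough to preserve what determines it.
    obtain ⟨z, hz, R, hR⟩ := hX.exists_determined hω hKc hKo hωK (hX.translate (-m) x₀) (r + m)
    obtain ⟨x, hx, R', hR'⟩ := ih (hX.translate m z) (max r R)
    have hxz : ∀ i : ℤ, -(m : ℤ) ≤ i → i < (max r R : ℕ) → x.1 i = z.1 (i + m) := fun i h1 h2 => by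
      rw [hx ⟨h1, h2⟩, IsMinimal.translate_apply]
    have hdet : ∀ y : X, EqOn y.1 x.1 (Ico (-m) (max r R : ℕ)) → y.1 (-m - 1) = z.1 (-1) := by
      intro y hy
      have := hR (hX.translate (-m) y) fun i hi => by
        obtain ⟨h1, h2⟩ := hi
        rw [IsMinimal.translate_apply, hy ⟨by omega, by push_cast; omega⟩,
          hxz _ (by omega) (by omega)]
        exact congrArg z.1 (by omega)
      rw [← this, IsMinimal.translate_apply]
      exact congrArg y.1 (by ring)
    refine ⟨x, fun i hi => ?_, max R' (max r R), fun y hy => ?_⟩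
    · obtain ⟨h1, h2⟩ := hi
      push_cast at h1
      rcases eq_or_lt_of_le h1 with h | h
      · have e1 := hdet x (eqOn_refl _ _)
        have e2 := hz (show (-1 : ℤ) ∈ Ico (-1) ((r + m : ℕ) : ℤ) by constructor <;> omega)
        rw [IsMinimal.translate_apply] at e2
        rw [show i = -m - 1 by omega, e1, e2]
        exact congrArg x₀.1 (by ring)
      · rw [hxz i (by omega) (by omega), hz ⟨by omega, by push_cast; omega⟩,
          IsMinimal.translate_apply]
        exact congrArg x₀.1 (by ring)
    · have hy' := hR' y (hy.mono (Ico_subset_Ico_right (by simp)))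
      have hyall : EqOn y.1 x.1 (Ico (-m) (max R' (max r R) : ℕ)) := fun i hi => by
        rcases le_or_gt 0 i with h | h
        · exact hy ⟨h, hi.2⟩
        · exact hy' ⟨hi.1, by omega⟩
      intro i hi
      obtain ⟨h1, h2⟩ := hi
      push_cast at h1
      rcases eq_or_lt_of_le h1 with h | h
      · have e1 := hdet x (eqOn_refl _ _)
        have e2 := hdet y (hyall.mono (Ico_subset_Ico_right (by simp)))
        rw [show i = -m - 1 by omega, e1, e2]
      · exact hyall ⟨by omega, h2⟩

theorem isClopen_cylinder (v : List A) : IsClopen (cylinder X v) := by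
  rcases (cylinder X v).eq_empty_or_nonempty with h | ⟨x, hx⟩
  · rw [h]
    exact isClopen_empty
  · have : factor x.1 0 v.length = v := hx
    rw [← this, cylinder_factor]
    exact isClopen_setOf_eqOn _ _ _

/-- Every nonempty open set contains a nonempty one-sided cylinder set. -/
theorem IsMinimal.exists_cylinder_subset (hX : IsMinimal X) {ω : X}
    (hω : ∀ U : Set X, IsOpen U → U.Nonempty → ∀ N : ℕ, ∃ m : ℕ, N ≤ m ∧ hX.translate m ω ∈ U)
    {K : Set X} (hKc : IsCompact K) (hKo : IsOpen K) (hωK : ω ∈ K) {U : Set X} (hU : IsOpen U)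
    (hne : U.Nonempty) :
    ∃ (x : X) (n : ℕ), 0 < n ∧ {y : X | EqOn y.1 x.1 (Ico 0 n)} ⊆ U := by
  obtain ⟨z, hz⟩ := hne
  obtain ⟨m, hm⟩ := exists_eqOn_subset hU hz
  obtain ⟨x, hx, R, hR⟩ := hX.exists_forcing hω hKc hKo hωK m z m
  refine ⟨x, max R (m + 1), by omega, fun y hy => hm fun i hi => ?_⟩
  rw [← hx hi]
  rcases le_or_gt 0 i with h | h
  · exact hy ⟨h, by have := hi.2; push_cast; omega⟩
  · exact hR y (EqOn.mono (Ico_subset_Ico_right (by simp)) hy) ⟨hi.1, by omega⟩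

end Forcing

end Subshift

/-! ### Counting the first N visits, forwards and backwards -/

open scoped ENNReal in
theorem tsum_indicator_one_eq_encard {Y : Type*} (P : ℕ → Set Y) (x : Y) :
    ∑' n, (P n).indicator (1 : Y → ℝ≥0∞) x = ({n | x ∈ P n}.encard : ℝ≥0∞) := by
  rw [← ENNReal.tsum_set_one, tsum_subtype _ fun _ => (1 : ℝ≥0∞)]
  rfl

section Counting

open scoped Classical in
theorem encard_setOf_count_lt {p : ℕ → Prop} (hp : {n | p n}.Infinite) (N : ℕ) :
    {n | p n ∧ Nat.count p n < N}.encard = N := by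
  have : {n | p n ∧ Nat.count p n < N} = Nat.nth p '' Iio N := by
    ext n
    constructor
    · rintro ⟨h1, h2⟩
      exact ⟨_, h2, Nat.nth_count h1⟩
    · rintro ⟨i, hi, rfl⟩
      exact ⟨Nat.nth_mem_of_infinite hp i, by rwa [Nat.count_nth_of_infinite hp]⟩
  rw [this, (Nat.nth_injective hp).injOn.encard_image]
  rw [← Finset.coe_Iio, Set.encard_coe_eq_coe_finsetCard, Nat.card_Iio]

open scoped Classical in
theorem count_reflect (p : ℕ → Prop) (n : ℕ) :
    Nat.count (fun t => p (n - t)) n = Nat.count (fun t => p (t + 1)) n := by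
  simp only [Nat.count_eq_card_filter_range, Finset.card_filter]
  rw [← Finset.sum_range_reflect]
  refine Finset.sum_congr rfl fun t ht => ?_
  have := Finset.mem_range.mp ht
  rw [show n - (n - 1 - t) = t + 1 by omega]

-- Since p holds at both 0 and n, the hits in (0, n] and in [0, n) are equally many, so counting
-- back from n selects the same first N hits.
open scoped Classical in
theorem encard_setOf_count_reflect_lt {p : ℕ → Prop} (hp : {n | p n}.Infinite) (h0 : p 0)
    (N : ℕ) : {n | p n ∧ Nat.count (fun t => p (n - t)) n < N}.encard = N := by
  rw [← encard_setOf_count_lt hp N]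
  congr 1
  ext n
  refine and_congr_right fun hn => ?_
  have h1 := Nat.count_succ p n
  have h2 := Nat.count_succ' p n
  rw [if_pos hn] at h1
  rw [if_pos h0] at h2
  rw [count_reflect]
  omega

end Counting

/-! ### Mass transport and Poincaré recurrence -/

section Transport

open scoped ENNReal

variable {Y : Type*} [MeasurableSpace Y] {μ : Measure Y} {σ : ℤ → Y → Y}

/-- Mass transport: if x sends a unit of mass by the translation -e n for each n with x ∈ P n, the
total sent equals the total received, term by term by invariance. -/
theorem lintegral_encard_translate (hσ : ∀ n, MeasurePreserving (σ n) μ μ) {P : ℕ → Set Y}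
    (hP : ∀ n, MeasurableSet (P n)) (e : ℕ → ℤ) :
    ∫⁻ x, ({n | x ∈ P n}.encard : ℝ≥0∞) ∂μ = ∫⁻ x, ({n | σ (e n) x ∈ P n}.encard : ℝ≥0∞) ∂μ := by
  have h1 := tsum_indicator_one_eq_encard P
  have h2 := tsum_indicator_one_eq_encard fun n => σ (e n) ⁻¹' P n
  simp only [mem_preimage] at h2
  simp_rw [← h1, ← h2]
  rw [lintegral_tsum fun n => (measurable_one.indicator (hP n)).aemeasurable,
    lintegral_tsum fun n =>
      (measurable_one.indicator ((hσ (e n)).measurable (hP n))).aemeasurable]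
  congr 1
  funext n
  rw [lintegral_indicator_one (hP n), lintegral_indicator_one ((hσ (e n)).measurable (hP n)),
    (hσ (e n)).measure_preimage (hP n).nullMeasurableSet]

/-- Poincaré recurrence for a possibly infinite invariant measure, in the case where all two-sided
orbits visit the set of finite measure `K` infinitely often. -/
theorem ae_exists_return (h0 : ∀ x, σ 0 x = x) (hadd : ∀ m n x, σ (m + n) x = σ m (σ n x))
    (hσ : ∀ n, MeasurePreserving (σ n) μ μ) {K : Set Y} (hK : MeasurableSet K) (hμK : μ K ≠ ⊤)
    (hinf : ∀ x, {n : ℤ | σ n x ∈ K}.Infinite) :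
    ∀ᵐ x ∂μ, x ∈ K → ∃ n : ℕ, 1 ≤ n ∧ σ n x ∈ K := by
  set W : Set Y := {x | x ∈ K ∧ ∀ n : ℕ, 1 ≤ n → σ n x ∉ K} with hW
  have hWm : MeasurableSet W := by
    have : W = K ∩ ⋂ n : ℕ, ⋂ _ : 1 ≤ n, (σ n ⁻¹' K)ᶜ := by
      ext x; simp [hW]
    rw [this]
    exact hK.inter (MeasurableSet.iInter fun n => MeasurableSet.iInter fun _ =>
      ((hσ n).measurable hK).compl)
  -- Each point of `W` sends mass to all its past visits to K, which are infinitely many as it has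
  -- no later ones. A point of K receives at most one unit, since a forward orbit meets `W` at most
  -- once. Hence ∞ · μ(W) ≤ μ(K).
  have key := lintegral_encard_translate hσ (P := fun n : ℕ => W ∩ σ (-n) ⁻¹' K)
    (fun n => hWm.inter ((hσ _).measurable hK)) (fun n => (n : ℤ))
  have hleft : ∫⁻ x, W.indicator (fun _ => (⊤ : ℝ≥0∞)) x ∂μ ≤
      ∫⁻ x, ({n : ℕ | x ∈ W ∩ σ (-n) ⁻¹' K}.encard : ℝ≥0∞) ∂μ := by
    refine lintegral_mono fun x => ?_
    by_cases hx : x ∈ W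
    swap
    · rw [indicator_of_notMem hx]
      exact zero_le
    rw [indicator_of_mem hx]
    have : {n : ℕ | x ∈ W ∩ σ (-n) ⁻¹' K}.Infinite := by
      intro hfin
      refine hinf x ((hfin.image fun n : ℕ => -(n : ℤ)).subset fun n hn => ?_)
      have hn0 : n ≤ 0 := by
        by_contra! h
        refine hx.2 n.toNat (by omega) ?_
        rw [Int.toNat_of_nonneg h.le]
        exact hn
      refine ⟨n.natAbs, ⟨hx, ?_⟩, by simp only; omega⟩
      have : -(n.natAbs : ℤ) = n := by omega
      rw [mem_preimage, this]
      exact hn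
    rw [this.encard_eq]
    simp
  have hright : ∫⁻ x, ({n : ℕ | σ n x ∈ W ∩ σ (-n) ⁻¹' K}.encard : ℝ≥0∞) ∂μ ≤
      ∫⁻ x, K.indicator 1 x ∂μ := by
    refine lintegral_mono fun x => ?_
    have hsub : {n : ℕ | σ n x ∈ W ∩ σ (-n) ⁻¹' K}.Subsingleton := by
      rintro m ⟨hm, -⟩ n ⟨hn, -⟩
      by_contra hne
      wlog hlt : m < n generalizing m n
      · exact this hn hm (Ne.symm hne) (by omega)
      refine hm.2 (n - m) (by omega) ?_
      rw [← hadd]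
      have : ((n - m : ℕ) : ℤ) + m = n := by omega
      rw [this]
      exact hn.1
    by_cases hx : x ∈ K
    · rw [indicator_of_mem hx]
      have := encard_le_one_iff_subsingleton.mpr hsub
      simpa using ENat.toENNReal_le.mpr this
    · have : {n : ℕ | σ n x ∈ W ∩ σ (-n) ⁻¹' K} = ∅ := by
        ext n
        simp only [mem_inter_iff, mem_preimage, ← hadd, neg_add_cancel, h0]
        simp [hx]
      rw [this]
      simp
  rw [lintegral_indicator_one hK] at hright
  rw [lintegral_indicator hWm, setLIntegral_const] at hleft
  have hW0 : μ W = 0 := by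
    by_contra h
    rw [ENNReal.top_mul h] at hleft
    exact hμK (top_le_iff.mp (hleft.trans (key.le.trans hright)))
  rw [measure_eq_zero_iff_ae_notMem] at hW0
  filter_upwards [hW0] with x hx hxK
  by_contra! h
  exact hx ⟨hxK, h⟩

theorem ae_infinite_forward (h0 : ∀ x, σ 0 x = x) (hadd : ∀ m n x, σ (m + n) x = σ m (σ n x))
    (hσ : ∀ n, MeasurePreserving (σ n) μ μ) {K : Set Y} (hK : MeasurableSet K) (hμK : μ K ≠ ⊤)
    (hinf : ∀ x, {n : ℤ | σ n x ∈ K}.Infinite) :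
    ∀ᵐ x ∂μ, {n : ℕ | σ n x ∈ K}.Infinite := by
  have h1 : ∀ᵐ x ∂μ, ∀ m : ℤ, σ m x ∈ K → ∃ n : ℕ, 1 ≤ n ∧ σ n (σ m x) ∈ K :=
    ae_all_iff.mpr fun m =>
      (hσ m).quasiMeasurePreserving.ae (ae_exists_return h0 hadd hσ hK hμK hinf)
  filter_upwards [h1] with x hx
  obtain ⟨m₀, hm₀⟩ := (hinf x).nonempty
  have hlarge : ∀ N : ℕ, ∃ m : ℤ, m₀ + N ≤ m ∧ σ m x ∈ K := by
    intro N
    induction N with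
    | zero => exact ⟨m₀, by simp, hm₀⟩
    | succ N ih =>
      obtain ⟨m, hm, hmK⟩ := ih
      obtain ⟨n, hn, hnK⟩ := hx m hmK
      exact ⟨n + m, by push_cast; omega, by rwa [hadd]⟩
  refine infinite_of_not_bddAbove fun ⟨B, hB⟩ => ?_
  obtain ⟨m, hm, hmK⟩ := hlarge (m₀.natAbs + B + 1)
  simp only [Nat.cast_add, Nat.cast_one] at hm
  have : m.toNat ≤ B := hB (show σ (m.toNat : ℤ) x ∈ K by
    rwa [Int.toNat_of_nonneg (by omega)])
  omega

theorem ae_infinite_backward (h0 : ∀ x, σ 0 x = x) (hadd : ∀ m n x, σ (m + n) x = σ m (σ n x))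
    (hσ : ∀ n, MeasurePreserving (σ n) μ μ) {K : Set Y} (hK : MeasurableSet K) (hμK : μ K ≠ ⊤)
    (hinf : ∀ x, {n : ℤ | σ n x ∈ K}.Infinite) :
    ∀ᵐ x ∂μ, {n : ℕ | σ (-n) x ∈ K}.Infinite :=
  ae_infinite_forward (σ := fun n => σ (-n)) (by simpa using h0)
    (fun m n x => by rw [neg_add, hadd]) (fun n => hσ (-n)) hK hμK fun x hfin =>
      hinf x (((hfin.image Neg.neg).subset fun n hn => ⟨-n, by simpa using hn, by simp⟩))

open scoped Classical in
/-- The integral over `K` of the number of visits to `V` before the `N`-th visit to `K`. -/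
theorem lintegral_encard_visits (h0 : ∀ x, σ 0 x = x)
    (hadd : ∀ m n x, σ (m + n) x = σ m (σ n x))
    (hσ : ∀ n, MeasurePreserving (σ n) μ μ) {K : Set Y} (hK : MeasurableSet K) (hμK : μ K ≠ ⊤)
    (hinf : ∀ x, {n : ℤ | σ n x ∈ K}.Infinite) {V : Set Y} (hV : MeasurableSet V) (hVK : V ⊆ K)
    (N : ℕ) :
    ∫⁻ x in K, ({n : ℕ | σ n x ∈ V ∧ Nat.count (fun t : ℕ => σ t x ∈ K) n < N}.encard : ℝ≥0∞) ∂μ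
      = N * μ V := by
  have hcount : ∀ n : ℕ, Measurable fun x => Nat.count (fun t : ℕ => σ t x ∈ K) n := by
    intro n
    induction n with
    | zero => simp
    | succ n ih =>
      simp only [Nat.count_succ]
      exact ih.add (Measurable.ite ((hσ n).measurable hK) measurable_const measurable_const)
  have hP : ∀ n : ℕ, MeasurableSet
      {x | x ∈ K ∧ σ n x ∈ V ∧ Nat.count (fun t : ℕ => σ t x ∈ K) n < N} := fun n =>
    hK.inter (((hσ n).measurable hV).inter ((hcount n) (measurableSet_Iio (a := N))))
  have key := lintegral_encard_translate hσ hP (fun n => -(n : ℤ))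
  have hleft : ∫⁻ x in K,
      ({n : ℕ | σ n x ∈ V ∧ Nat.count (fun t : ℕ => σ t x ∈ K) n < N}.encard : ℝ≥0∞) ∂μ =
      ∫⁻ x, ({n : ℕ | x ∈ K ∧ σ n x ∈ V ∧
        Nat.count (fun t : ℕ => σ t x ∈ K) n < N}.encard : ℝ≥0∞) ∂μ := by
    rw [← lintegral_indicator hK]
    congr 1
    funext x
    by_cases hx : x ∈ K <;> simp [hx]
  rw [hleft]
  refine key.trans ?_
  -- Seen from the receiving end, a point of V gets one unit from each of the last N visits to K up
  -- to and including the present one; backward recurrence ensures there are N of them.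
  have hright : ∀ᵐ x ∂μ, ({n : ℕ | σ (-n) x ∈ {x | x ∈ K ∧ σ n x ∈ V ∧
      Nat.count (fun t : ℕ => σ t x ∈ K) n < N}}.encard : ℝ≥0∞) =
      V.indicator (fun _ => (N : ℝ≥0∞)) x := by
    filter_upwards [ae_infinite_backward h0 hadd hσ hK hμK hinf] with x hx
    have hc : ∀ n : ℕ, Nat.count (fun t : ℕ => σ t (σ (-n) x) ∈ K) n =
        Nat.count (fun t : ℕ => σ (-((n - t : ℕ) : ℤ)) x ∈ K) n := fun n => by
      simp only [Nat.count_eq_card_filter_range]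
      congr 1
      refine Finset.filter_congr fun t ht => ?_
      have := Finset.mem_range.mp ht
      rw [← hadd, show (t : ℤ) + -n = -((n - t : ℕ) : ℤ) by omega]
    by_cases hxV : x ∈ V
    · rw [indicator_of_mem hxV]
      have := encard_setOf_count_reflect_lt (p := fun n : ℕ => σ (-n) x ∈ K) hx
        (by simpa [h0] using hVK hxV) N
      rw [show (N : ℝ≥0∞) = ((N : ℕ∞) : ℝ≥0∞) by simp, ← this]
      congr 2
      ext n
      simp only [mem_ofPred_eq, hc]
      rw [← hadd, add_neg_cancel, h0]
      simp [hxV]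
    · rw [indicator_of_notMem hxV]
      have : {n : ℕ | σ (-n) x ∈ {x | x ∈ K ∧ σ n x ∈ V ∧
          Nat.count (fun t : ℕ => σ t x ∈ K) n < N}} = ∅ := by
        ext n
        simp only [mem_ofPred_eq, ← hadd, add_neg_cancel, h0]
        simp [hxV]
      simp only [mem_ofPred_eq] at this ⊢
      rw [this]
      simp
  rw [lintegral_congr_ae hright, lintegral_indicator hV, setLIntegral_const]

open scoped Classical in
/-- If the frequency of visits to `V ⊆ K` among visits to `K` converges uniformly to `c`, then `c`
is the ratio of the measures of `V` and `K`. -/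
theorem measure_eq_of_uniform_visits (h0 : ∀ x, σ 0 x = x)
    (hadd : ∀ m n x, σ (m + n) x = σ m (σ n x))
    (hσ : ∀ n, MeasurePreserving (σ n) μ μ) {K : Set Y} (hK : MeasurableSet K) (hμK : μ K ≠ ⊤)
    (hinf : ∀ x, {n : ℤ | σ n x ∈ K}.Infinite) {V : Set Y} (hV : MeasurableSet V) (hVK : V ⊆ K)
    {c : ℝ} (hc : ∀ ε > 0, ∃ N : ℕ, 0 < N ∧ ∀ x ∈ K, {n : ℕ | σ n x ∈ K}.Infinite →
      ∃ a : ℕ, {n : ℕ | σ n x ∈ V ∧ Nat.count (fun t : ℕ => σ t x ∈ K) n < N}.encard = a ∧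
        |(a : ℝ) - c * N| ≤ ε * N) :
    μ V = ENNReal.ofReal c * μ K := by
  have hbound : ∀ ε > 0, μ V ≤ ENNReal.ofReal (c + ε) * μ K ∧
      ENNReal.ofReal (c - ε) * μ K ≤ μ V := by
    intro ε hε
    obtain ⟨N, hN, hNx⟩ := hc ε hε
    have hI := lintegral_encard_visits h0 hadd hσ hK hμK hinf hV hVK N
    have hae : ∀ᵐ x ∂μ.restrict K, ENNReal.ofReal ((c - ε) * N) ≤
        ({n : ℕ | σ n x ∈ V ∧ Nat.count (fun t : ℕ => σ t x ∈ K) n < N}.encard : ℝ≥0∞) ∧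
        ({n : ℕ | σ n x ∈ V ∧ Nat.count (fun t : ℕ => σ t x ∈ K) n < N}.encard : ℝ≥0∞) ≤
          ENNReal.ofReal ((c + ε) * N) := by
      filter_upwards [ae_restrict_mem hK,
        ae_restrict_of_ae (ae_infinite_forward h0 hadd hσ hK hμK hinf)] with x hx hxi
      obtain ⟨a, ha, hac⟩ := hNx x hx hxi
      rw [ha, ENat.toENNReal_coe, ← ENNReal.ofReal_natCast]
      obtain ⟨h1, h2⟩ := abs_le.mp hac
      constructor <;> exact ENNReal.ofReal_le_ofReal (by linarith)
    have hN0 : (N : ℝ≥0∞) ≠ 0 := by exact_mod_cast hN.ne'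
    have hNt : (N : ℝ≥0∞) ≠ ⊤ := ENNReal.natCast_ne_top N
    constructor
    · have := lintegral_mono_ae (hae.mono fun x h => h.2)
      rw [hI, setLIntegral_const, mul_comm (c + ε), ENNReal.ofReal_mul (by positivity),
        ENNReal.ofReal_natCast, mul_assoc] at this
      exact (ENNReal.mul_le_mul_iff_right hN0 hNt).mp this
    · have := lintegral_mono_ae (hae.mono fun x h => h.1)
      rw [hI, setLIntegral_const, mul_comm (c - ε), ENNReal.ofReal_mul (by positivity),
        ENNReal.ofReal_natCast, mul_assoc] at this
      exact (ENNReal.mul_le_mul_iff_right hN0 hNt).mp this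
  have hlim := tendsto_one_div_add_atTop_nhds_zero_nat (𝕜 := ℝ)
  refine le_antisymm ?_ ?_
  · have ht : Tendsto (fun n : ℕ => ENNReal.ofReal (c + 1 / ((n : ℝ) + 1)) * μ K) atTop
        (nhds (ENNReal.ofReal (c + 0) * μ K)) :=
      ENNReal.Tendsto.mul_const (ENNReal.tendsto_ofReal (hlim.const_add c)) (Or.inr hμK)
    rw [add_zero] at ht
    exact ge_of_tendsto' ht fun n => (hbound _ (by positivity)).1
  · have ht : Tendsto (fun n : ℕ => ENNReal.ofReal (c - 1 / ((n : ℝ) + 1)) * μ K) atTop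
        (nhds (ENNReal.ofReal (c - 0) * μ K)) :=
      ENNReal.Tendsto.mul_const (ENNReal.tendsto_ofReal (hlim.const_sub c)) (Or.inr hμK)
    rw [sub_zero] at ht
    exact le_of_tendsto' ht fun n => (hbound _ (by positivity)).2

end Transport

/-! ### Limits of normalized orbit-counting measures -/

open scoped Classical in
theorem card_filter_Ico_add_le (P : ℤ → Prop) (a b p : ℤ) :
    ((Finset.Ico a b).filter fun m => P (p + m)).card ≤
      ((Finset.Ico a b).filter P).card + 2 * p.natAbs := by
  have hsub : ((Finset.Ico a b).filter fun m => P (p + m)).image (p + ·) ⊆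
      (Finset.Ico a b).filter P ∪ (Finset.Ico (a - p.natAbs) a ∪ Finset.Ico b (b + p.natAbs)) := by
    intro m hm
    simp only [Finset.mem_image, Finset.mem_filter, Finset.mem_Ico, Finset.mem_union] at hm ⊢
    obtain ⟨n, ⟨⟨h1, h2⟩, h3⟩, rfl⟩ := hm
    by_cases h : a ≤ p + n ∧ p + n < b
    · exact Or.inl ⟨h, h3⟩
    · right
      omega
  have h1 := Finset.card_le_card hsub
  rw [Finset.card_image_of_injective _ (add_right_injective p)] at h1
  have h2 := Finset.card_union_le ((Finset.Ico a b).filter P)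
    (Finset.Ico (a - p.natAbs) a ∪ Finset.Ico b (b + p.natAbs))
  have h3 := Finset.card_union_le (Finset.Ico (a - p.natAbs) a) (Finset.Ico b (b + p.natAbs))
  simp only [Int.card_Ico] at h3
  omega

theorem exists_tendsto_ultrafilter {ι : Type*} (U : Ultrafilter ι) {s : ι → ℝ} {B : ℝ}
    (hs : ∀ i, |s i| ≤ B) : ∃ L, Tendsto s U (nhds L) := by
  obtain ⟨L, -, hL⟩ := isCompact_iff_ultrafilter_le_nhds.mp (isCompact_Icc (a := -B) (b := B))
    (U.map s) (by
      rw [le_principal_iff]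
      exact Filter.mem_map.mpr (Eventually.of_forall fun i => abs_le.mp (hs i)))
  exact ⟨L, hL⟩

namespace Subshift

/-- The translation by `n` as a homeomorphism. -/
def IsMinimal.homeo {A : Type*} [TopologicalSpace A] {X : Set (ℤ → A)} (hX : IsMinimal X) (n : ℤ) :
    X ≃ₜ X where
  toFun := hX.translate n
  invFun := hX.translate (-n)
  left_inv x := by rw [← hX.translate_add, neg_add_cancel, hX.translate_zero]
  right_inv x := by rw [← hX.translate_add, add_neg_cancel, hX.translate_zero]
  continuous_toFun := hX.continuous_translate n
  continuous_invFun := hX.continuous_translate (-n)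

section Averages

variable {A : Type*} [TopologicalSpace A] {X : Set (ℤ → A)}

open scoped Classical in
/-- The number of visits of `x` to `S` at times in `[a, b)`. -/
noncomputable def IsMinimal.visits (hX : IsMinimal X) (x : X) (S : Set X) (a b : ℤ) : ℕ :=
  ((Finset.Ico a b).filter fun m => hX.translate m x ∈ S).card

theorem IsMinimal.exists_bound_sum (hX : IsMinimal X) {K : Set X} (hKo : IsOpen K)
    (hne : K.Nonempty) (x : X) {f : X → ℝ} (hf : Continuous f) (hfc : HasCompactSupport f) :
    ∃ B : ℝ, ∀ a b : ℤ, |(∑ m ∈ Finset.Ico a b, f (hX.translate m x)) / hX.visits x K a b| ≤ B := by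
  classical
  obtain ⟨M, hM⟩ := hfc.exists_bound_of_continuous hf
  have hM0 : 0 ≤ M := (norm_nonneg _).trans (hM x)
  obtain ⟨t, ht⟩ := hfc.isCompact.elim_finite_subcover (fun n : ℤ => hX.translate n ⁻¹' K)
      (fun n => hKo.preimage (hX.continuous_translate n))
      (fun x _ => mem_iUnion.mpr (hX.exists_translate_mem hKo hne x))
  -- Moving a window by p gains at most 2|p| visits to K, and this excess is at most 2|p| times the
  -- number of visits once there is one.
  refine ⟨M * ∑ p ∈ t, (1 + 2 * (p.natAbs : ℝ)), fun a b => ?_⟩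
  rcases Nat.eq_zero_or_pos (hX.visits x K a b) with h0 | hpos
  -- Without visits to K the quotient is 0 by the convention for division by zero.
  · rw [h0, Nat.cast_zero, div_zero, abs_zero]
    positivity
  have hpos' : (1 : ℝ) ≤ hX.visits x K a b := by exact_mod_cast hpos
  rw [abs_div, Nat.abs_cast, div_le_iff₀ (by linarith)]
  have hpt : ∀ m : ℤ, |f (hX.translate m x)| ≤
      M * ∑ p ∈ t, if hX.translate (p + m) x ∈ K then (1 : ℝ) else 0 := by
    intro m
    by_cases hm : hX.translate m x ∈ tsupport f
    · obtain ⟨p, hp, hpK⟩ := mem_iUnion₂.mp (ht hm)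
      have h1 : (1 : ℝ) ≤ ∑ p ∈ t, if hX.translate (p + m) x ∈ K then (1 : ℝ) else 0 := by
        have := Finset.single_le_sum (s := t)
          (f := fun p => if hX.translate (p + m) x ∈ K then (1 : ℝ) else 0)
          (fun i _ => by positivity) hp
        rwa [if_pos (by rw [hX.translate_add]; exact hpK)] at this
      calc |f (hX.translate m x)| ≤ M * 1 := by rw [mul_one]; exact hM _
        _ ≤ _ := by gcongr
    · rw [image_eq_zero_of_notMem_tsupport hm, abs_zero]
      exact mul_nonneg hM0 (Finset.sum_nonneg fun i _ => by positivity)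
  calc |∑ m ∈ Finset.Ico a b, f (hX.translate m x)|
      ≤ ∑ m ∈ Finset.Ico a b, |f (hX.translate m x)| := Finset.abs_sum_le_sum_abs _ _
    _ ≤ ∑ m ∈ Finset.Ico a b, M * ∑ p ∈ t, if hX.translate (p + m) x ∈ K then (1 : ℝ) else 0 :=
        Finset.sum_le_sum fun m _ => hpt m
    _ = M * ∑ p ∈ t, ∑ m ∈ Finset.Ico a b,
          if hX.translate (p + m) x ∈ K then (1 : ℝ) else 0 := by
        rw [← Finset.mul_sum, Finset.sum_comm]
    _ ≤ M * ∑ p ∈ t, (1 + 2 * (p.natAbs : ℝ)) * hX.visits x K a b := by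
        gcongr with p hp
        rw [Finset.sum_boole]
        have := card_filter_Ico_add_le (fun m => hX.translate m x ∈ K) a b p
        have h2 : (((Finset.Ico a b).filter fun m => hX.translate (p + m) x ∈ K).card : ℝ) ≤
            hX.visits x K a b + 2 * p.natAbs := by
          exact_mod_cast this
        refine h2.trans ?_
        nlinarith [(Nat.cast_nonneg p.natAbs : (0 : ℝ) ≤ p.natAbs)]
    _ = _ := by rw [← Finset.sum_mul, mul_assoc]

variable [Finite A] [DiscreteTopology A] [MeasurableSpace A] [BorelSpace A]

/-- Limits of normalized counting measures along pieces of the orbit of `x` that visit `K` more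
and more often are invariant Radon measures. -/
theorem IsMinimal.exists_limit_measure (hX : IsMinimal X) [LocallyCompactSpace X] {K : Set X}
    (hKo : IsOpen K) (hne : K.Nonempty) (x : X) {a b : ℕ → ℤ} (hab : ∀ i, a i ≤ b i)
    (hn : Tendsto (fun i => hX.visits x K (a i) (b i)) atTop atTop) :
    ∃ (μ : Measure X) (U : Ultrafilter ℕ), IsInvariantRadon hX.map μ ∧ (U : Filter ℕ) ≤ atTop ∧
      ∀ C : Set X, IsCompact C → IsOpen C →
        Tendsto (fun i => (hX.visits x C (a i) (b i) : ℝ) / hX.visits x K (a i) (b i)) U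
          (nhds (μ.real C)) := by
  classical
  -- A single ultrafilter gives limits for all test functions at once, which makes the limit
  -- functional linear.
  set U : Ultrafilter ℕ := Ultrafilter.of atTop with hU
  have hUle : (U : Filter ℕ) ≤ atTop := Ultrafilter.of_le _
  set avg : (X → ℝ) → ℕ → ℝ := fun f i =>
    (∑ m ∈ Finset.Ico (a i) (b i), f (hX.translate m x)) / hX.visits x K (a i) (b i) with havg
  have hlim : ∀ f : CompactlySupportedContinuousMap X ℝ, ∃ L, Tendsto (avg f) U (nhds L) := by
    intro f
    obtain ⟨B, hB⟩ := hX.exists_bound_sum hKo hne x f.continuous f.hasCompactSupport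
    exact exists_tendsto_ultrafilter U fun i => hB (a i) (b i)
  choose L hL using hlim
  let Λlin : CompactlySupportedContinuousMap X ℝ →ₗ[ℝ] ℝ :=
    { toFun := L
      map_add' := fun f g => by
        refine tendsto_nhds_unique (hL (f + g)) (((hL f).add (hL g)).congr fun i => ?_)
        simp [havg, Finset.sum_add_distrib, add_div]
      map_smul' := fun r f => by
        refine tendsto_nhds_unique (hL (r • f)) (((hL f).const_mul r).congr fun i => ?_)
        simp [havg, ← Finset.mul_sum, mul_div_assoc] }
  let Λ : CompactlySupportedContinuousMap X ℝ →ₚ[ℝ] ℝ := PositiveLinearMap.mk₀ Λlin fun f hf =>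
    ge_of_tendsto' (hL f) fun i => div_nonneg (Finset.sum_nonneg fun m _ => hf _) (Nat.cast_nonneg _)
  have hΛ : ∀ f, Λ f = L f := fun f => rfl
  set μ : Measure X := RealRMK.rieszMeasure Λ with hμ
  have hreg : μ.Regular := RealRMK.regular_rieszMeasure Λ
  have hint : ∀ f : CompactlySupportedContinuousMap X ℝ, ∫ y, f y ∂μ = L f := fun f => by
    rw [hμ, RealRMK.integral_rieszMeasure, hΛ]
  have hmeas : Measurable hX.map := (hX.continuous_translate 1).measurable
  have hinv : Measure.map hX.map μ = μ := by
    have : (Measure.map hX.map μ).Regular := Measure.Regular.map (hX.homeo 1)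
    refine Measure.ext_of_integral_eq_on_compactlySupported fun f => ?_
    have hfc : Continuous (fun y => f y) := f.continuous
    rw [integral_map hmeas.aemeasurable hfc.aestronglyMeasurable, hint]
    let g : CompactlySupportedContinuousMap X ℝ :=
      ⟨⟨fun y => f (hX.map y), f.continuous.comp (hX.continuous_translate 1)⟩,
        f.hasCompactSupport.comp_homeomorph (hX.homeo 1)⟩
    refine (hint g).trans ?_
    obtain ⟨M, hM⟩ := f.hasCompactSupport.exists_bound_of_continuous f.continuous
    -- The sums of f ∘ T and f telescope to two end terms, which are bounded while the number of
    -- visits to K tends to infinity.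
    have hdiff : ∀ i, avg g i - avg f i =
        (f (hX.translate (b i) x) - f (hX.translate (a i) x)) / hX.visits x K (a i) (b i) := by
      intro i
      have htel : ∀ n : ℕ, (∑ m ∈ Finset.Ico (a i) (a i + n), g (hX.translate m x)) -
          ∑ m ∈ Finset.Ico (a i) (a i + n), f (hX.translate m x) =
          f (hX.translate (a i + n) x) - f (hX.translate (a i) x) := by
        intro n
        induction n with
        | zero => simp
        | succ n ih =>
          have hIco : Finset.Ico (a i) (a i + (n + 1 : ℕ)) =
              insert (a i + n) (Finset.Ico (a i) (a i + n)) := by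
            ext m
            simp only [Finset.mem_Ico, Finset.mem_insert]
            push_cast
            omega
          have hg : g (hX.translate (a i + n) x) = f (hX.translate (a i + (n + 1 : ℕ)) x) := by
            change f (hX.translate 1 (hX.translate (a i + n) x)) = _
            rw [← hX.translate_add]
            congr 2
            push_cast
            ring
          rw [hIco, Finset.sum_insert (by simp), Finset.sum_insert (by simp), hg]
          linarith
      have := htel (b i - a i).toNat
      rw [Int.toNat_of_nonneg (sub_nonneg.mpr (hab i)), add_sub_cancel] at this
      simp only [havg]
      rw [← sub_div, this]
    have hzero : Tendsto (fun i => avg g i - avg f i) U (nhds 0) := by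
      have h1 : Tendsto (fun i => (2 * M) / (hX.visits x K (a i) (b i) : ℝ)) U (nhds 0) :=
        (tendsto_const_nhds.div_atTop (tendsto_natCast_atTop_atTop.comp hn)).mono_left hUle
      refine squeeze_zero_norm (fun i => ?_) h1
      rw [hdiff, norm_div, Real.norm_natCast]
      gcongr
      exact (norm_sub_le _ _).trans (by linarith [hM (hX.translate (b i) x), hM (hX.translate (a i) x)])
    have := tendsto_nhds_unique hzero ((hL g).sub (hL f))
    linarith
  refine ⟨μ, U, ⟨fun C hC => hC.measure_lt_top, ⟨hmeas, hinv⟩⟩, hUle, fun C hC hCo => ?_⟩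
  let g : CompactlySupportedContinuousMap X ℝ :=
    ⟨⟨C.indicator 1, IsClopen.continuous_indicator ⟨hC.isClosed, hCo⟩ continuous_one⟩,
      HasCompactSupport.intro hC fun y hy => indicator_of_notMem hy _⟩
  have h1 : μ.real C = L g := by
    rw [← hint g, ← integral_indicator_one hCo.measurableSet]
    rfl
  rw [h1]
  refine (hL g).congr fun i => ?_
  simp only [havg, IsMinimal.visits]
  congr 1
  rw [← Finset.sum_boole]
  refine Finset.sum_congr rfl fun m _ => ?_
  change C.indicator 1 _ = _
  simp [indicator_apply]

end Averages

end Subshift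

/-! ### Local sets and the determination of invariant measures -/

namespace Subshift

/-- Membership in `C` depends only on the coordinates in `[a, b)`. -/
def IsLocalOn {A : Type*} {X : Set (ℤ → A)} (C : Set X) (a b : ℤ) : Prop :=
  ∀ x y : X, EqOn x.1 y.1 (Ico a b) → (x ∈ C ↔ y ∈ C)

namespace IsLocalOn

variable {A : Type*} {X : Set (ℤ → A)} {C D : Set X} {a b : ℤ}

theorem mono (hC : IsLocalOn C a b) {a' b' : ℤ} (ha : a' ≤ a) (hb : b ≤ b') :
    IsLocalOn C a' b' := fun x y h => hC x y (h.mono (Ico_subset_Ico ha hb))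

theorem inter (hC : IsLocalOn C a b) (hD : IsLocalOn D a b) : IsLocalOn (C ∩ D) a b :=
  fun x y h => and_congr (hC x y h) (hD x y h)

theorem compl (hC : IsLocalOn C a b) : IsLocalOn Cᶜ a b :=
  fun x y h => not_congr (hC x y h)

theorem iInter {ι : Sort*} {C : ι → Set X} (hC : ∀ i, IsLocalOn (C i) a b) :
    IsLocalOn (⋂ i, C i) a b := fun x y h => by
  simp only [mem_iInter]
  exact forall_congr' fun i => hC i x y h

theorem setOf_eqOn (z : ℤ → A) (a b : ℤ) : IsLocalOn {x : X | EqOn x.1 z (Ico a b)} a b :=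
  fun _ _ h => ⟨fun hx => h.symm.trans hx, fun hy => h.trans hy⟩

theorem preimage_translate [TopologicalSpace A] (hX : IsMinimal X) (hC : IsLocalOn C a b) (n : ℤ) :
    IsLocalOn (hX.translate n ⁻¹' C) (a + n) (b + n) := fun x y h =>
  hC _ _ fun i hi => h ⟨by linarith [hi.1], by linarith [hi.2]⟩

theorem isOpen [TopologicalSpace A] [DiscreteTopology A] (hC : IsLocalOn C a b) : IsOpen C := by
  refine isOpen_iff_mem_nhds.mpr fun x hx => ?_
  filter_upwards [(isClopen_setOf_eqOn (X := X) x.1 a b).isOpen.mem_nhds (eqOn_refl _ _)] with y hy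
  exact (hC y x hy).mpr hx

/-- As A is finite, C splits into the finitely many cylinders given by the words on [a, b) that its
points carry. -/
theorem measure_eq [Finite A] [TopologicalSpace A] [DiscreteTopology A] [MeasurableSpace A]
    [BorelSpace A] {μ ν : Measure X} (hC : IsLocalOn C a b)
    (h : ∀ x ∈ C, μ {y : X | EqOn y.1 x.1 (Ico a b)} = ν {y : X | EqOn y.1 x.1 (Ico a b)}) :
    μ C = ν C := by
  let ρ : X → Ico a b → A := fun x i => x.1 i
  have hρ : ∀ x : X, ρ ⁻¹' {ρ x} = {y : X | EqOn y.1 x.1 (Ico a b)} := by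
    intro x
    ext y
    simp only [mem_preimage, mem_singleton_iff, mem_ofPred_eq, ρ]
    exact ⟨fun h i hi => congrFun h ⟨i, hi⟩, fun h => funext fun i => h i.2⟩
  have hunion : C = ⋃ w ∈ ρ '' C, ρ ⁻¹' {w} := by
    ext y
    simp only [mem_iUnion, mem_preimage, mem_singleton_iff, exists_prop, exists_eq_right']
    refine ⟨fun hy => ⟨y, hy, rfl⟩, fun ⟨x, hx, hxy⟩ => (hC y x ?_).mpr hx⟩
    have : y ∈ ρ ⁻¹' {ρ x} := hxy.symm
    rwa [hρ] at this
  have hmeas : ∀ w ∈ ρ '' C, MeasurableSet (ρ ⁻¹' {w}) := by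
    rintro _ ⟨x, -, rfl⟩
    rw [hρ]
    exact (isClopen_setOf_eqOn _ _ _).isOpen.measurableSet
  have hdisj : (ρ '' C).PairwiseDisjoint fun w => ρ ⁻¹' {w} :=
    (pairwiseDisjoint_fiber ρ _)
  have hcount : (ρ '' C).Countable := (toFinite _).countable
  rw [hunion, measure_biUnion hcount hdisj hmeas, measure_biUnion hcount hdisj hmeas]
  congr 1
  funext ⟨w, hw⟩
  obtain ⟨x, hx, rfl⟩ := hw
  simp only [hρ]
  exact h x hx

end IsLocalOn

section Uniqueness

variable {A : Type*} [Finite A] [TopologicalSpace A] [DiscreteTopology A] [MeasurableSpace A]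
  [BorelSpace A] {X : Set (ℤ → A)}

theorem _root_.IsInvariantRadon.measurePreserving_translate {hX : IsMinimal X} {μ : Measure X}
    (hμ : IsInvariantRadon hX.map μ) (n : ℤ) : MeasurePreserving (hX.translate n) μ μ := by
  have hnat : ∀ n : ℕ, MeasurePreserving (hX.translate n) μ μ := fun n => by
    have : hX.translate n = hX.map^[n] := funext fun x => (hX.map_iterate n x).symm
    rw [this]
    exact hμ.measurePreserving.iterate n
  obtain ⟨m, rfl | rfl⟩ := n.eq_nat_or_neg
  · exact hnat m
  · exact MeasurePreserving.symm (hX.homeo m).toMeasurableEquiv (hnat m)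

/-- Two invariant Radon measures that agree on the one-sided cylinders inside a nonempty one-sided
cylinder `V` agree on all sets that depend on finitely many coordinates `≥ 0`. -/
theorem IsMinimal.measure_eq_of_isLocalOn (hX : IsMinimal X) {μ ν : Measure X}
    (hμ : IsInvariantRadon hX.map μ) (hν : IsInvariantRadon hX.map ν) {z : X} {n₀ : ℕ}
    (hVμ : μ {x : X | EqOn x.1 z.1 (Ico 0 n₀)} ≠ ⊤) (hVν : ν {x : X | EqOn x.1 z.1 (Ico 0 n₀)} ≠ ⊤)
    (hinf : ∀ x, {n : ℤ | hX.translate n x ∈ {x : X | EqOn x.1 z.1 (Ico 0 n₀)}}.Infinite)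
    (hagree : ∀ x : X, EqOn x.1 z.1 (Ico 0 n₀) → ∀ n : ℕ, n₀ ≤ n →
      μ {y : X | EqOn y.1 x.1 (Ico 0 n)} = ν {y : X | EqOn y.1 x.1 (Ico 0 n)})
    {E : Set X} {M : ℕ} (hE : IsLocalOn E 0 M) : μ E = ν E := by
  set V : Set X := {x : X | EqOn x.1 z.1 (Ico 0 n₀)} with hV
  have hVl : IsLocalOn V 0 n₀ := IsLocalOn.setOf_eqOn _ _ _
  have hVm : MeasurableSet V := hVl.isOpen.measurableSet
  -- `D n` collects the points of E whose last visit to V at a time ≤ 0 took place at time -n.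
  let D : ℕ → Set X := fun n =>
    E ∩ (hX.translate (-n) ⁻¹' V ∩ ⋂ i : Fin n, (hX.translate (-(i : ℕ)) ⁻¹' V)ᶜ)
  have htm : ∀ n, Measurable (hX.translate n) := fun n => (hX.continuous_translate n).measurable
  have hDm : ∀ n, MeasurableSet (D n) := fun n =>
    hE.isOpen.measurableSet.inter (((htm _) hVm).inter
      (MeasurableSet.iInter fun i => ((htm _) hVm).compl))
  have hDdisj : Pairwise (Function.onFun Disjoint D) := by
    intro m n hmn
    wlog h : m < n generalizing m n
    · exact (this hmn.symm (by omega)).symm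
    refine Set.disjoint_left.mpr fun x hx hx' => ?_
    exact mem_iInter.mp hx'.2.2 ⟨m, h⟩ hx.2.1
  have hsum : ∀ ρ : Measure X, IsInvariantRadon hX.map ρ → ρ V ≠ ⊤ → ρ E = ∑' n, ρ (D n) := by
    intro ρ hρ hρV
    rw [← measure_iUnion hDdisj hDm]
    refine measure_congr ?_
    filter_upwards [ae_infinite_backward hX.translate_zero hX.translate_add
      hρ.measurePreserving_translate hVm hρV hinf] with x hx
    refine propext ⟨fun hxE => ?_, fun hxD => ?_⟩
    · classical
      have hex : ∃ n : ℕ, hX.translate (-n) x ∈ V := hx.nonempty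
      exact mem_iUnion.mpr ⟨Nat.find hex, hxE, Nat.find_spec hex,
        mem_iInter.mpr fun i => Nat.find_min hex i.2⟩
    · obtain ⟨n, hn⟩ := mem_iUnion.mp hxD
      exact hn.1
  rw [hsum μ hμ hVμ, hsum ν hν hVν]
  congr 1
  funext n
  rw [← (hμ.measurePreserving_translate n).measure_preimage (hDm n).nullMeasurableSet,
    ← (hν.measurePreserving_translate n).measure_preimage (hDm n).nullMeasurableSet]
  have hpre : hX.translate n ⁻¹' D n = hX.translate n ⁻¹' E ∩
      (V ∩ ⋂ i : Fin n, (hX.translate (n - (i : ℕ) : ℤ) ⁻¹' V)ᶜ) := by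
    ext x
    simp only [D, mem_preimage, mem_inter_iff, mem_iInter, mem_compl_iff, ← hX.translate_add,
      neg_add_cancel, hX.translate_zero]
    simp only [neg_add_eq_sub]
  -- Shifting that last visit to time 0 puts the piece inside V and leaves only conditions on
  -- nonnegative coordinates.
  have hlocal : IsLocalOn (hX.translate n ⁻¹' D n) 0 (n₀ + n + M : ℕ) := by
    rw [hpre]
    refine ((hE.preimage_translate hX n).mono (by omega) (by push_cast; omega)).inter
      ((hVl.mono le_rfl (by push_cast; omega)).inter (IsLocalOn.iInter fun i => ?_))
    have := i.2
    exact ((hVl.preimage_translate hX _).compl).mono (by omega) (by push_cast; omega)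
  refine hlocal.measure_eq fun x hx => hagree x ?_ _ (by omega)
  rw [hpre] at hx
  exact hx.2.1

/-- A shift turns every local set into one on nonnegative coordinates. The local sets form a
π-system generating the Borel sets, and the translates of V form a countable cover by sets of finite
measure. -/
theorem IsMinimal.measure_ext (hX : IsMinimal X) {μ ν : Measure X}
    (hμ : IsInvariantRadon hX.map μ) (hν : IsInvariantRadon hX.map ν) {z : X} {n₀ : ℕ}
    (hVμ : μ {x : X | EqOn x.1 z.1 (Ico 0 n₀)} ≠ ⊤) (hVν : ν {x : X | EqOn x.1 z.1 (Ico 0 n₀)} ≠ ⊤)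
    (hinf : ∀ x, {n : ℤ | hX.translate n x ∈ {x : X | EqOn x.1 z.1 (Ico 0 n₀)}}.Infinite)
    (hagree : ∀ x : X, EqOn x.1 z.1 (Ico 0 n₀) → ∀ n : ℕ, n₀ ≤ n →
      μ {y : X | EqOn y.1 x.1 (Ico 0 n)} = ν {y : X | EqOn y.1 x.1 (Ico 0 n)}) :
    μ = ν := by
  have hVl : IsLocalOn {x : X | EqOn x.1 z.1 (Ico 0 n₀)} 0 n₀ := IsLocalOn.setOf_eqOn _ _ _
  have hall : ∀ (E : Set X) (m : ℕ), IsLocalOn E (-m) m → μ E = ν E := by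
    intro E m hE
    have hEm : MeasurableSet E := hE.isOpen.measurableSet
    rw [← (hμ.measurePreserving_translate m).measure_preimage hEm.nullMeasurableSet,
      ← (hν.measurePreserving_translate m).measure_preimage hEm.nullMeasurableSet]
    exact hX.measure_eq_of_isLocalOn hμ hν hVμ hVν hinf hagree (M := 2 * m)
      ((hE.preimage_translate hX m).mono (by omega) (by push_cast; omega))
  refine Measure.ext_of_generateFrom_of_cover (S := {E : Set X | ∃ m : ℕ, IsLocalOn E (-m) m})
    (T := range fun p : ℤ => hX.translate p ⁻¹' {x : X | EqOn x.1 z.1 (Ico 0 n₀)}) ?_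
    (countable_range _) ?_ ?_ ?_ ?_ ?_
  · refine le_antisymm ?_ (MeasurableSpace.generateFrom_le ?_)
    · have : @Measurable X (ℤ → A) (MeasurableSpace.generateFrom
          {E : Set X | ∃ m : ℕ, IsLocalOn E (-m) m}) inferInstance Subtype.val := by
        refine @measurable_pi_lambda _ _ _ (_) _ _ fun i => ?_
        refine @measurable_to_countable' _ _ _ _ (_) _ fun c => ?_
        refine MeasurableSpace.measurableSet_generateFrom ⟨i.natAbs + 1, fun x y h => ?_⟩
        have hi := h (show i ∈ Ico (-((i.natAbs + 1 : ℕ) : ℤ)) ((i.natAbs + 1 : ℕ) : ℤ) by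
          constructor <;> omega)
        simp [hi]
      exact measurable_iff_comap_le.mp this
    · rintro E ⟨m, hE⟩
      exact hE.isOpen.measurableSet
  · rintro E ⟨m, hE⟩ F ⟨n, hF⟩ -
    exact ⟨max m n, (hE.mono (by simp) (by simp)).inter (hF.mono (by simp) (by simp))⟩
  · refine eq_univ_of_forall fun x => ?_
    obtain ⟨n, hn⟩ := (hinf x).nonempty
    exact mem_sUnion.mpr ⟨_, mem_range_self n, hn⟩
  · rintro _ ⟨p, rfl⟩
    simp only
    rwa [(hμ.measurePreserving_translate p).measure_preimage hVl.isOpen.measurableSet.nullMeasurableSet]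
  · rintro _ ⟨p, rfl⟩ E ⟨m, hE⟩
    refine hall _ (m + n₀ + p.natAbs) ((hE.mono ?_ ?_).inter
      ((hVl.preimage_translate hX p).mono ?_ ?_)) <;> omega
  · rintro _ ⟨p, rfl⟩
    refine hall _ (n₀ + p.natAbs) ((hVl.preimage_translate hX p).mono ?_ ?_) <;> omega

end Uniqueness

end Subshift

/-! ### Word counts, visits and return times -/

theorem tendstoUniformly_div_of_abs_sub_le {ι : Type*} {F G : ℕ → ι → ℝ} {B c : ℝ}
    (h : ∀ n j, |F n j - G n j| ≤ B)
    (hF : TendstoUniformly (fun n j => F n j / (n : ℝ)) (fun _ => c) atTop) :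
    TendstoUniformly (fun n j => G n j / (n : ℝ)) (fun _ => c) atTop := by
  rw [Metric.tendstoUniformly_iff] at hF ⊢
  intro ε hε
  have hB : Tendsto (fun n : ℕ => B / (n : ℝ)) atTop (nhds 0) :=
    tendsto_const_nhds.div_atTop tendsto_natCast_atTop_atTop
  filter_upwards [hF (ε / 2) (half_pos hε), hB.eventually_lt_const (half_pos hε)] with n h1 h2 j
  have h3 : |F n j / n - G n j / n| ≤ B / n := by
    rw [← sub_div, abs_div, Nat.abs_cast]
    gcongr
    exact h n j
  have h4 := h1 j
  rw [Real.dist_eq] at h4 ⊢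
  calc |c - G n j / n| ≤ |c - F n j / n| + |F n j / n - G n j / n| := abs_sub_le _ _ _
    _ < ε := by linarith

namespace Subshift

theorem take_drop_factor_eq_iff {A : Type*} (x : ℤ → A) (a : ℤ) (L i : ℕ) (v : List A)
    (hi : i < L) : ((factor x a L).drop i).take v.length = v ↔
      i + v.length ≤ L ∧ ∀ t (ht : t < v.length), x (a + i + t) = v[t] := by
  constructor
  · intro h
    have hlen : i + v.length ≤ L := by
      have := congrArg List.length h
      simp [factor] at this
      omega
    refine ⟨hlen, fun t ht => ?_⟩
    have : (((factor x a L).drop i).take v.length)[t]'(by rw [h]; exact ht) = v[t] := by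
      simp only [h]
    rw [← this]
    simp [factor, add_assoc]
  · rintro ⟨hlen, h⟩
    refine List.ext_getElem (by simp [factor]; omega) fun t h1 h2 => ?_
    rw [← h t h2]
    simp [factor, add_assoc]

section Visits

variable {A : Type*} [TopologicalSpace A] {X : Set (ℤ → A)}

theorem IsMinimal.translate_mem_cylinder_iff (hX : IsMinimal X) (x : X) (m : ℤ) (v : List A) :
    hX.translate m x ∈ cylinder X v ↔ ∀ t (ht : t < v.length), x.1 (m + t) = v[t] := by
  simp only [cylinder, mem_ofPred_eq, factor_eq_iff, IsMinimal.translate_apply]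
  refine forall₂_congr fun t ht => ?_
  rw [zero_add, add_comm]

theorem IsMinimal.visits_mono (hX : IsMinimal X) (x : X) (S : Set X) (a : ℤ) {b b' : ℤ}
    (h : b ≤ b') : hX.visits x S a b ≤ hX.visits x S a b' := by
  classical
  exact Finset.card_le_card (Finset.filter_subset_filter _ (Finset.Ico_subset_Ico_right h))

theorem IsMinimal.visits_succ (hX : IsMinimal X) (x : X) {S : Set X} {a b : ℤ} (hab : a ≤ b)
    (hb : hX.translate b x ∈ S) : hX.visits x S a (b + 1) = hX.visits x S a b + 1 := by
  classical
  have : Finset.Ico a (b + 1) = insert b (Finset.Ico a b) := by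
    ext m
    simp only [Finset.mem_Ico, Finset.mem_insert]
    omega
  unfold visits
  rw [this, Finset.filter_insert, if_pos hb, Finset.card_insert_of_notMem (by simp)]

open scoped Classical in
theorem IsMinimal.count_eq_visits (hX : IsMinimal X) (x : X) (S : Set X) (a : ℤ) (n : ℕ) :
    Nat.count (fun t : ℕ => hX.translate t (hX.translate a x) ∈ S) n =
      hX.visits x S a (a + n) := by
  rw [Nat.count_eq_card_filter_range, visits]
  refine Finset.card_bij (fun t _ => a + t) ?_ ?_ ?_
  · intro t ht
    simp only [Finset.mem_filter, Finset.mem_range, Finset.mem_Ico, ← hX.translate_add] at ht ⊢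
    refine ⟨by omega, ?_⟩
    rw [add_comm]
    exact ht.2
  · intro s _ t _ h
    simpa using h
  · intro m hm
    simp only [Finset.mem_filter, Finset.mem_Ico] at hm
    refine ⟨(m - a).toNat, ?_, by omega⟩
    simp only [Finset.mem_filter, Finset.mem_range, ← hX.translate_add]
    refine ⟨by omega, ?_⟩
    rw [Int.toNat_of_nonneg (by omega), sub_add_cancel]
    exact hm.2

/-- Occurrences of a word in a block and visits to the cylinder set differ only by
boundary effects. -/
theorem IsMinimal.abs_numOcc_sub_visits_le (hX : IsMinimal X) (x : X) (v : List A) {a b : ℤ}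
    (hab : a ≤ b) :
    |(numOcc v (block x.1 a b) : ℝ) - hX.visits x (cylinder X v) a b| ≤ v.length + 1 := by
  classical
  set L : ℕ := (b - a + 1).toNat with hL
  have hLb : (L : ℤ) = b - a + 1 := Int.toNat_of_nonneg (by omega)
  set S : Finset ℕ := (Finset.range L).filter fun i =>
    i + v.length ≤ L ∧ hX.translate (a + i) x ∈ cylinder X v with hS
  have hocc : numOcc v (block x.1 a b) = S.card := by
    rw [numOcc, ← Set.ncard_coe_finset]
    congr 1
    ext i
    have hlen : (block x.1 a b).length = L := by simp [block, factor, hL]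
    simp only [mem_ofPred_eq, hlen, hS, Finset.coe_filter, Finset.mem_range]
    refine and_congr_right fun hi => ?_
    rw [hX.translate_mem_cylinder_iff]
    exact take_drop_factor_eq_iff x.1 a L i v hi
  set F : Finset ℤ := (Finset.Ico a b).filter fun m => hX.translate m x ∈ cylinder X v with hF
  have hvis : hX.visits x (cylinder X v) a b = F.card := by
    rw [IsMinimal.visits, hF]
  -- The block includes its end point b, while visits are counted on [a, b).
  have h1 : S.card ≤ F.card + 1 := by
    have hsub : S.image (fun i : ℕ => a + (i : ℤ)) ⊆ insert b F := by
      intro m hm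
      obtain ⟨i, hi, rfl⟩ := Finset.mem_image.mp hm
      simp only [hS, hF, Finset.mem_filter, Finset.mem_range, Finset.mem_insert,
        Finset.mem_Ico] at hi ⊢
      by_cases h : a + (i : ℤ) = b
      · exact Or.inl h
      · exact Or.inr ⟨by omega, hi.2.2⟩
    have := Finset.card_le_card hsub
    rw [Finset.card_image_of_injective _ fun i j h => by simpa using h] at this
    exact this.trans (Finset.card_insert_le _ _)
  -- Visits within the last |v| positions may start occurrences that overrun the block.
  have h2 : F.card ≤ S.card + v.length := by
    have hsub : F ⊆ S.image (fun i : ℕ => a + (i : ℤ)) ∪ Finset.Ico (b - v.length) b := by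
      intro m hm
      simp only [hS, hF, Finset.mem_filter, Finset.mem_range, Finset.mem_union, Finset.mem_image,
        Finset.mem_Ico] at hm ⊢
      by_cases h : m < b - v.length
      · refine Or.inl ⟨(m - a).toNat, ⟨by omega, by omega, ?_⟩, by omega⟩
        rw [Int.toNat_of_nonneg (by omega), add_sub_cancel]
        exact hm.2
      · exact Or.inr (by omega)
    have h3 := (Finset.card_le_card hsub).trans (Finset.card_union_le _ _)
    have h4 := Finset.card_image_le (s := S) (f := fun i : ℕ => a + (i : ℤ))
    rw [Int.card_Ico] at h3
    omega
  rw [hocc, hvis, abs_le]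
  have h1' : (S.card : ℝ) ≤ F.card + 1 := by exact_mod_cast h1
  have h2' : (F.card : ℝ) ≤ S.card + v.length := by exact_mod_cast h2
  constructor <;> linarith [(Nat.cast_nonneg v.length : (0 : ℝ) ≤ v.length)]

/-- The half-open window holds exactly the returns k_j, …, k_{j+n-1}, so dividing by n normalizes by
the visits to K. -/
theorem IsMinimal.visits_returnTimes (hX : IsMinimal X) {K : Set X} {ω : X} {k : ℕ → ℕ}
    (hk : StrictMono k) (hret : ∀ m : ℕ, hX.translate m ω ∈ K ↔ m ∈ range k) (j n : ℕ) :
    hX.visits ω K (k j) (k (j + n)) = n := by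
  classical
  have : (Finset.Ico (k j : ℤ) (k (j + n))).filter (fun m => hX.translate m ω ∈ K) =
      (Finset.Ico j (j + n)).image fun l => (k l : ℤ) := by
    ext m
    simp only [Finset.mem_filter, Finset.mem_Ico, Finset.mem_image]
    constructor
    · rintro ⟨⟨h1, h2⟩, h3⟩
      have hm : (m.toNat : ℤ) = m := Int.toNat_of_nonneg (by omega)
      rw [← hm] at h3
      obtain ⟨l, hl⟩ := (hret _).mp h3
      refine ⟨l, ⟨hk.le_iff_le.mp (by omega), hk.lt_iff_lt.mp (by omega)⟩, by omega⟩
    · rintro ⟨l, ⟨h1, h2⟩, rfl⟩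
      exact ⟨⟨by exact_mod_cast hk.monotone h1, by exact_mod_cast hk h2⟩,
        (hret _).mpr (mem_range_self l)⟩
  rw [visits, this, Finset.card_image_of_injective _ fun a b h => hk.injective (by exact_mod_cast h)]
  simp

open scoped Classical in
/-- Every point with infinitely many forward visits to `K` sees, up to its `N`-th visit, the same
pattern as `ω` does from some return time on. -/
theorem IsMinimal.exists_encard_eq_visits (hX : IsMinimal X) {K V : Set X} (hK : IsClopen K)
    (hV : IsClopen V) (hVK : V ⊆ K) {ω : X} {k : ℕ → ℕ} (hk : StrictMono k)
    (hret : ∀ m : ℕ, hX.translate m ω ∈ K ↔ m ∈ range k)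
    (hω : ∀ U : Set X, IsOpen U → U.Nonempty → ∀ N : ℕ, ∃ m : ℕ, N ≤ m ∧ hX.translate m ω ∈ U)
    {x : X} (hx : x ∈ K) (hinf : {n : ℕ | hX.translate n x ∈ K}.Infinite) (N : ℕ) :
    ∃ j, {n : ℕ | hX.translate n x ∈ V ∧
      Nat.count (fun t : ℕ => hX.translate t x ∈ K) n < N}.encard =
        hX.visits ω V (k j) (k (j + N)) := by
  -- Indexing starts at 0: exactly N visits, the one at time 0 included, come before time `M`.
  set M : ℕ := Nat.nth (fun t : ℕ => hX.translate t x ∈ K) N with hM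
  have hMN : Nat.count (fun t : ℕ => hX.translate t x ∈ K) M = N := Nat.count_nth_of_infinite hinf N
  have hloc : ∀ S : Set X, IsClopen S → ∀ n : ℕ,
      IsOpen {y : X | hX.translate n y ∈ S ↔ hX.translate n x ∈ S} := by
    intro S hS n
    by_cases h : hX.translate n x ∈ S
    · simp only [h, iff_true]
      exact hS.isOpen.preimage (hX.continuous_translate n)
    · simp only [h, iff_false]
      exact hS.compl.isOpen.preimage (hX.continuous_translate n)
  -- The points of K with the same itinerary as x through K and V before time `M`. The orbit of ω
  -- enters this open set, necessarily at some k_j.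
  have hopen : IsOpen (K ∩ ⋂ n ∈ Finset.range M,
      ({y : X | hX.translate n y ∈ K ↔ hX.translate n x ∈ K} ∩
        {y : X | hX.translate n y ∈ V ↔ hX.translate n x ∈ V})) :=
    hK.isOpen.inter (isOpen_biInter_finset fun n _ => (hloc K hK n).inter (hloc V hV n))
  obtain ⟨m, -, hmK, hm⟩ := hω _ hopen ⟨x, hx, mem_iInter₂.mpr fun n _ => ⟨Iff.rfl, Iff.rfl⟩⟩ 0
  obtain ⟨j, rfl⟩ := (hret m).mp hmK
  refine ⟨j, ?_⟩
  set y := hX.translate (k j) ω with hy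
  have hyK : ∀ n < M, (hX.translate n y ∈ K ↔ hX.translate n x ∈ K) := fun n hn =>
    (mem_iInter₂.mp hm n (Finset.mem_range.mpr hn)).1
  have hyV : ∀ n < M, (hX.translate n y ∈ V ↔ hX.translate n x ∈ V) := fun n hn =>
    (mem_iInter₂.mp hm n (Finset.mem_range.mpr hn)).2
  have hcount : ∀ n ≤ M, Nat.count (fun t : ℕ => hX.translate t y ∈ K) n =
      Nat.count (fun t : ℕ => hX.translate t x ∈ K) n := by
    intro n hn
    rw [Nat.count_eq_card_filter_range, Nat.count_eq_card_filter_range]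
    congr 1
    exact Finset.filter_congr fun t ht => hyK t ((Finset.mem_range.mp ht).trans_le hn)
  have hset : {n : ℕ | hX.translate n x ∈ V ∧
      Nat.count (fun t : ℕ => hX.translate t x ∈ K) n < N} =
      {n : ℕ | hX.translate n y ∈ V ∧ Nat.count (fun t : ℕ => hX.translate t y ∈ K) n < N} := by
    ext n
    simp only [mem_ofPred_eq]
    rcases lt_or_ge n M with h | h
    · rw [hyV n h, hcount n h.le]
    · have h1 := Nat.count_monotone (fun t : ℕ => hX.translate t x ∈ K) h
      have h2 := Nat.count_monotone (fun t : ℕ => hX.translate t y ∈ K) h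
      rw [hcount M le_rfl] at h2
      constructor <;> rintro ⟨-, h3⟩ <;> omega
  rw [hset, IsMinimal.visits, ← Set.encard_coe_eq_coe_finsetCard]
  rw [← Function.Injective.encard_image (f := fun n : ℕ => (k j : ℤ) + n)
    (fun a b h => by simpa using h)]
  congr 1
  have hN := hX.visits_returnTimes hk hret j N
  -- As V ⊆ K, time m is itself a visit to K; having fewer than N visits before it therefore means
  -- lying before k_{j+N}.
  have hlt : ∀ m : ℤ, k j ≤ m → hX.translate m ω ∈ V →
      (hX.visits ω K (k j) m < N ↔ m < k (j + N)) := by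
    intro m hm hmV
    constructor
    · intro h
      by_contra! h'
      have := hX.visits_mono ω K (k j) h'
      omega
    · intro h
      have h1 := hX.visits_succ ω hm (hVK hmV)
      have h2 := hX.visits_mono ω K (k j) (show m + 1 ≤ k (j + N) by omega)
      omega
  ext m
  simp only [mem_image, mem_ofPred_eq, hy, hX.count_eq_visits, Finset.coe_filter, Finset.mem_Ico]
  constructor
  · rintro ⟨n, ⟨h1, h2⟩, rfl⟩
    rw [← hX.translate_add, add_comm] at h1
    exact ⟨⟨by omega, (hlt _ (by omega) h1).mp h2⟩, h1⟩
  · rintro ⟨⟨h1, h2⟩, h3⟩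
    have he : (k j : ℤ) + (m - k j).toNat = m := by omega
    refine ⟨(m - k j).toNat, ⟨?_, ?_⟩, he⟩
    · rw [← hX.translate_add, add_comm, he]
      exact h3
    · rw [he]
      exact (hlt m h1 h3).mpr h2

end Visits

end Subshift

/-! ### Ergodicity and the equivalence -/

theorem IsInvariantRadon.smul {Y : Type*} [TopologicalSpace Y] [MeasurableSpace Y] {T : Y → Y}
    {μ : Measure Y} (hμ : IsInvariantRadon T μ) (c : ℝ≥0) : IsInvariantRadon T (c • μ) where
  lt_top_of_isCompact C hC := by
    rw [Measure.smul_apply]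
    exact ENNReal.mul_lt_top ENNReal.coe_lt_top (hμ.lt_top_of_isCompact C hC)
  measurePreserving := hμ.measurePreserving.smul_measure c

theorem IsInvariantRadon.restrict {Y : Type*} [TopologicalSpace Y] [MeasurableSpace Y] {T : Y → Y}
    {μ : Measure Y} (hμ : IsInvariantRadon T μ) {B : Set Y} (hB : MeasurableSet B)
    (hTB : T ⁻¹' B = B) : IsInvariantRadon T (μ.restrict B) where
  lt_top_of_isCompact C hC :=
    (Measure.restrict_apply_le B C).trans_lt (hμ.lt_top_of_isCompact C hC)
  measurePreserving := by
    have := hμ.measurePreserving.restrict_preimage hB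
    rwa [hTB] at this

/-- Unique invariant Radon measures are ergodic. -/
theorem HasUniqueInvariantRadon.ergodic {Y : Type*} [TopologicalSpace Y] [MeasurableSpace Y]
    {T : Y → Y} (h : HasUniqueInvariantRadon T) {μ : Measure Y} (hμ : IsInvariantRadon T μ)
    (h0 : μ ≠ 0) : Ergodic T μ := by
  obtain ⟨ρ, -, -, huniq⟩ := h
  refine ⟨hμ.measurePreserving, ⟨fun {B} hB hTB => ?_⟩⟩
  obtain ⟨c, hc⟩ := huniq μ hμ
  -- The restriction to B is d • ρ and vanishes on the complement, so either d = 0 or the complement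
  -- is null.
  obtain ⟨d, hd⟩ := huniq _ (hμ.restrict hB hTB)
  have hc0 : c ≠ 0 := by
    rintro rfl
    exact h0 (by simpa using hc)
  have hcompl : d * ρ Bᶜ = 0 := by
    have h1 : (μ.restrict B) Bᶜ = 0 := by rw [Measure.restrict_apply hB.compl]; simp
    rwa [hd, Measure.smul_apply, ENNReal.smul_def, smul_eq_mul] at h1
  rw [eventuallyConst_set']
  rcases mul_eq_zero.mp hcompl with hd0 | hρ
  · left
    rw [ENNReal.coe_eq_zero.mp hd0, zero_smul] at hd
    rw [ae_eq_empty, ← Measure.restrict_eq_zero]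
    exact hd
  · right
    rw [ae_eq_univ, hc]
    simp [hρ]

namespace Subshift

section UniqueErgodicity

variable {A : Type*} [Finite A] [TopologicalSpace A] [DiscreteTopology A]
  [MeasurableSpace A] [BorelSpace A] {X : Set (ℤ → A)} {K : Set X} {ω : X} {k : ℕ → ℕ}

/-- The condition of uniform frequencies in terms of visits to cylinder sets. -/
theorem IsMinimal.tendstoUniformly_numOcc_iff {A : Type*} [TopologicalSpace A] {X : Set (ℤ → A)}
    (hX : IsMinimal X) {ω : X} {k : ℕ → ℕ} (hk : StrictMono k) (v : List A)
    (c : ℝ) :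
    TendstoUniformly (fun (n j : ℕ) =>
      (numOcc v (block ω.1 (k j : ℤ) (k (j + n) : ℤ)) : ℝ) / (n : ℝ)) (fun _ : ℕ => c) atTop ↔
    TendstoUniformly (fun (n j : ℕ) =>
      (hX.visits ω (cylinder X v) (k j) (k (j + n)) : ℝ) / (n : ℝ)) (fun _ : ℕ => c) atTop := by
  have hle : ∀ j n : ℕ, (k j : ℤ) ≤ k (j + n) := fun j n => by
    exact_mod_cast hk.monotone (by omega : j ≤ j + n)
  constructor
  · exact tendstoUniformly_div_of_abs_sub_le fun n j =>
      hX.abs_numOcc_sub_visits_le ω v (hle j n)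
  · refine tendstoUniformly_div_of_abs_sub_le (B := v.length + 1) fun n j => ?_
    rw [abs_sub_comm]
    exact hX.abs_numOcc_sub_visits_le ω v (hle j n)

theorem IsMinimal.exists_limit_of_windows (hX : IsMinimal X) [LocallyCompactSpace X]
    (hKc : IsCompact K) (hKo : IsOpen K) (hω : ω ∈ K) (hk : StrictMono k)
    (hret : ∀ m : ℕ, hX.translate m ω ∈ K ↔ m ∈ range k) {j n : ℕ → ℕ}
    (hn : Tendsto n atTop atTop) :
    ∃ (μ : Measure X) (U : Ultrafilter ℕ), IsInvariantRadon hX.map μ ∧ (U : Filter ℕ) ≤ atTop ∧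
      μ.real K = 1 ∧ ∀ C : Set X, IsCompact C → IsOpen C →
        Tendsto (fun i => (hX.visits ω C (k (j i)) (k (j i + n i)) : ℝ) / n i) U
          (nhds (μ.real C)) := by
  obtain ⟨μ, U, hμ, hU, hlim⟩ := hX.exists_limit_measure hKo ⟨ω, hω⟩ ω
    (a := fun i => k (j i)) (b := fun i => k (j i + n i))
    (fun i => by exact_mod_cast hk.monotone (by omega : j i ≤ j i + n i))
    (by simpa only [hX.visits_returnTimes hk hret] using hn)
  simp only [hX.visits_returnTimes hk hret] at hlim
  refine ⟨μ, U, hμ, hU, ?_, hlim⟩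
  have h1 := hlim K hKc hKo
  simp only [hX.visits_returnTimes hk hret] at h1
  refine tendsto_nhds_unique h1 (tendsto_const_nhds.congr' ?_)
  filter_upwards [hU (hn.eventually_ge_atTop 1)] with i hi
  rw [div_self]
  have : 1 ≤ n i := hi
  positivity

/-- The limit must be ρ(V)/ρ(K): windows that stay ε away from it would have a limit measure c • ρ
with cρ(K) = 1, hence with V of mass ρ(V)/ρ(K). -/
theorem IsMinimal.exists_frequency (hX : IsMinimal X) [LocallyCompactSpace X]
    (hKc : IsCompact K) (hKo : IsOpen K) (hω : ω ∈ K) (hk : StrictMono k)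
    (hret : ∀ m : ℕ, hX.translate m ω ∈ K ↔ m ∈ range k)
    (huniq : HasUniqueInvariantRadon hX.map) {V : Set X} (hVc : IsCompact V) (hVo : IsOpen V) :
    ∃ c : ℝ, TendstoUniformly (fun (n j : ℕ) =>
      (hX.visits ω V (k j) (k (j + n)) : ℝ) / (n : ℝ)) (fun _ : ℕ => c) atTop := by
  obtain ⟨ρ, -, -, huniq⟩ := huniq
  refine ⟨ρ.real V / ρ.real K, ?_⟩
  by_contra hnot
  rw [Metric.tendstoUniformly_iff] at hnot
  push Not at hnot
  obtain ⟨ε, hε, hfreq⟩ := hnot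
  have hex : ∀ i : ℕ, ∃ n : ℕ, i ≤ n ∧ ∃ j : ℕ, ε ≤ dist (ρ.real V / ρ.real K)
      ((hX.visits ω V (k j) (k (j + n)) : ℝ) / (n : ℝ)) := fun i => by
    obtain ⟨n, hn, j, hj⟩ := frequently_atTop.mp hfreq i
    exact ⟨n, hn, j, hj⟩
  choose n hn j hj using hex
  obtain ⟨μ, U, hμ, -, hμK, hlim⟩ := hX.exists_limit_of_windows hKc hKo hω hk hret (j := j)
    (tendsto_atTop_mono hn tendsto_id)
  obtain ⟨c, rfl⟩ := huniq μ hμ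
  simp only [measureReal_nnreal_smul_apply] at hμK hlim
  have hc : ρ.real V / ρ.real K = c * ρ.real V := by
    have : ρ.real K ≠ 0 := right_ne_zero_of_mul (hμK.trans_ne one_ne_zero)
    field_simp
    linear_combination (-ρ.real V) * hμK
  have hdist := (tendsto_const_nhds (x := (c : ℝ) * ρ.real V)).dist (hlim V hVc hVo)
  rw [dist_self] at hdist
  obtain ⟨i, hi⟩ := (hdist.eventually_lt_const hε).exists
  have := hj i
  rw [hc] at this
  linarith

theorem IsMinimal.measure_eq_of_frequency (hX : IsMinimal X)
    (hKc : IsCompact K) (hKo : IsOpen K) (hk : StrictMono k)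
    (hret : ∀ m : ℕ, hX.translate m ω ∈ K ↔ m ∈ range k)
    (hω : ∀ U : Set X, IsOpen U → U.Nonempty → ∀ N : ℕ, ∃ m : ℕ, N ≤ m ∧ hX.translate m ω ∈ U)
    (hinf : ∀ x, {n : ℤ | hX.translate n x ∈ K}.Infinite) {V : Set X} (hV : IsClopen V)
    (hVK : V ⊆ K) {c : ℝ} (hc : TendstoUniformly (fun (n j : ℕ) =>
      (hX.visits ω V (k j) (k (j + n)) : ℝ) / (n : ℝ)) (fun _ : ℕ => c) atTop)
    {μ : Measure X} (hμ : IsInvariantRadon hX.map μ) :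
    μ V = ENNReal.ofReal c * μ K := by
  refine measure_eq_of_uniform_visits hX.translate_zero hX.translate_add
    hμ.measurePreserving_translate hKo.measurableSet (hμ.lt_top_of_isCompact K hKc).ne hinf
    hV.isOpen.measurableSet hVK fun ε hε => ?_
  rw [Metric.tendstoUniformly_iff] at hc
  obtain ⟨N, hN, hN0⟩ := ((hc ε hε).and (eventually_gt_atTop 0)).exists
  refine ⟨N, hN0, fun x hx hxi => ?_⟩
  obtain ⟨j, hj⟩ := hX.exists_encard_eq_visits ⟨hKc.isClosed, hKo⟩ hV hVK hk hret hω hx hxi N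
  refine ⟨_, hj, ?_⟩
  have h := (hN j).le
  have hN' : (0 : ℝ) < N := by exact_mod_cast hN0
  rw [dist_comm, Real.dist_eq] at h
  calc _ = |(hX.visits ω V (k j) (k (j + N)) : ℝ) / N - c| * N := by
        rw [← abs_of_pos hN', ← abs_mul, abs_of_pos hN', sub_mul, div_mul_cancel₀ _ hN'.ne']
    _ ≤ ε * N := by gcongr

theorem IsMinimal.hasUniqueInvariantRadon (hX : IsMinimal X) [LocallyCompactSpace X]
    (hKc : IsCompact K) (hKo : IsOpen K) (hωK : ω ∈ K) (hk : StrictMono k)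
    (hret : ∀ m : ℕ, hX.translate m ω ∈ K ↔ m ∈ range k)
    (hfreq : ∀ v ∈ language X, v ≠ [] → cylinder X v ⊆ K → ∃ c : ℝ, TendstoUniformly
      (fun (n j : ℕ) => (hX.visits ω (cylinder X v) (k j) (k (j + n)) : ℝ) / (n : ℝ))
      (fun _ : ℕ => c) atTop) :
    HasUniqueInvariantRadon hX.map := by
  have hω : ∀ U : Set X, IsOpen U → U.Nonempty → ∀ N : ℕ, ∃ m : ℕ, N ≤ m ∧
      hX.translate m ω ∈ U := fun U hU hne N =>
    hX.exists_ge_translate_mem hKc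
      (fun N => ⟨k N, hk.le_apply, (hret _).mpr (mem_range_self N)⟩) hU hne N
  have hinf : ∀ U : Set X, IsOpen U → U.Nonempty → ∀ x,
      {n : ℤ | hX.translate n x ∈ U}.Infinite := fun U hU hne x =>
    hX.infinite_visits hU (ω := ω) (infinite_of_not_bddAbove fun ⟨B, hB⟩ => by
      obtain ⟨m, hm, hmU⟩ := hω U hU hne (B.natAbs + 1)
      have : (m : ℤ) ≤ B := hB hmU
      omega) x
  obtain ⟨μ, U, hμ, hU, hμK, -⟩ := hX.exists_limit_of_windows hKc hKo hωK hk hret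
    (j := fun _ => 0) tendsto_id
  have hμK' : μ K = 1 := by
    rwa [measureReal_def, ENNReal.toReal_eq_one_iff] at hμK
  -- Since μ(K) = 1, the scalar can only be ν(K).
  refine ⟨μ, hμ, fun h => by simp [h] at hμK, fun ν hν => ⟨(ν K).toNNReal, ?_⟩⟩
  have hνK : ((ν K).toNNReal : ENNReal) = ν K :=
    ENNReal.coe_toNNReal (hν.lt_top_of_isCompact K hKc).ne
  obtain ⟨z, n₀, hn₀, hVK⟩ := hX.exists_cylinder_subset hω hKc hKo hωK hKo ⟨ω, hωK⟩
  have hρ := hμ.smul (ν K).toNNReal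
  refine hX.measure_ext hν hρ (z := z) (n₀ := n₀)
    ((measure_mono hVK).trans_lt (hν.lt_top_of_isCompact K hKc)).ne
    ((measure_mono hVK).trans_lt (hρ.lt_top_of_isCompact K hKc)).ne
    (hinf _ (isClopen_setOf_eqOn _ _ _).isOpen ⟨z, eqOn_refl _ _⟩) fun x hx n hn => ?_
  have hlen : (factor x.1 0 n).length = n := by simp [factor]
  have hsub : cylinder X (factor x.1 0 n) ⊆ K := by
    rw [cylinder_factor]
    exact fun y hy => hVK fun i hi => (hy ⟨hi.1, by have := hi.2; omega⟩).trans (hx hi)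
  obtain ⟨c, hc⟩ := hfreq (factor x.1 0 n) ⟨x, x.2, 0, by rw [hlen]⟩
    (by rw [← List.length_pos_iff, hlen]; omega) hsub
  have hmeas : ∀ {ρ : Measure X}, IsInvariantRadon hX.map ρ →
      ρ (cylinder X (factor x.1 0 n)) = ENNReal.ofReal c * ρ K := fun hρ =>
    hX.measure_eq_of_frequency hKc hKo hk hret hω (hinf K hKo ⟨ω, hωK⟩) (isClopen_cylinder _)
      hsub hc hρ
  rw [← cylinder_factor, hmeas hν, hmeas hρ, Measure.smul_apply, hμK', ENNReal.smul_def, hνK]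
  simp

end UniqueErgodicity

end Subshift

theorem lemma5p3 {A : Type*} [Finite A] [TopologicalSpace A] [DiscreteTopology A]
    [MeasurableSpace A] [BorelSpace A]
    {X : Set (ℤ → A)} (hX : Subshift.IsMinimal X) (hlc : LocallyCompactSpace X)
    {K : Set X} (hKc : IsCompact K) (hKo : IsOpen K)
    (ω : X) (hω : ω ∈ K)
    -- `k 0 < k 1 < …` lists all return times of `ω` to `K`; `k 0 = 0` because `ω ∈ K`
    (k : ℕ → ℕ) (hk : StrictMono k) (hret : Set.range k = {m : ℕ | hX.map^[m] ω ∈ K}) :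
    (HasUniqueInvariantRadon hX.map ↔
      ∀ v ∈ Subshift.language X, v ≠ [] → Subshift.cylinder X v ⊆ K →
        ∃ c : ℝ, TendstoUniformly
          (fun (n j : ℕ) =>
            (Subshift.numOcc v (Subshift.block ω.1 (k j : ℤ) (k (j + n) : ℤ)) : ℝ) / (n : ℝ))
          (fun _ : ℕ => c) atTop) ∧
    (HasUniqueInvariantRadon hX.map →
      ∀ μ : Measure X, IsInvariantRadon hX.map μ → μ ≠ 0 → Ergodic hX.map μ) := by
  have hret' : ∀ m : ℕ, hX.translate m ω ∈ K ↔ m ∈ range k := fun m => by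
    rw [hret, ← hX.map_iterate]
    rfl
  refine ⟨⟨fun huniq v _ _ hvK => ?_, fun hfreq => ?_⟩, fun huniq μ hμ h0 => huniq.ergodic hμ h0⟩
  · have hv := Subshift.isClopen_cylinder (X := X) v
    obtain ⟨c, hc⟩ := hX.exists_frequency hKc hKo hω hk hret' huniq
      (hKc.of_isClosed_subset hv.isClosed hvK) hv.isOpen
    exact ⟨c, (hX.tendstoUniformly_numOcc_iff hk v c).mpr hc⟩
  · refine hX.hasUniqueInvariantRadon hKc hKo hω hk hret' fun v hv hne hvK => ?_
    obtain ⟨c, hc⟩ := hfreq v hv hne hvK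
    exact ⟨c, (hX.tendstoUniformly_numOcc_iff hk v c).mp hc⟩
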